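/- Let $(\theta_j)_{j\ge1}$ and $(\kappa_j)_{j\ge1}$ be sequences of non-negative real numbers, where $(\kappa_j)$ is non-arithmetic (no integer $j_0>1$ divides every $j$ with $\kappa_j\neq0$) and $\kappa_j>0$ for some $j\ge2$. Put $$g_\theta(z)=\sum_{j\ge1}\frac{\theta_j}{j}z^j,\qquad g_\kappa(z)=\sum_{j\ge1}\frac{\kappa_j}{j}z^j,\qquad G_N(z)=g_\theta(z)+N g_\kappa(z),$$ let $H_N=\frac1{N!}\sum_{\sigma\in\mathfrak S_N}\prod_{j=1}^N(\theta_j+N\kappa_j)^{C_j(\sigma)}$, where $C_j(\sigma)$ is the number of cycles of length $j$ of $\sigma$, and let $[z^N]F(z)$ denote the coefficient of $z^N$ in the power series expansion of $F$ at $0$. Suppose that $g_\kappa$ has radius of convergence $R\in(0,\infty)$, that $g_\theta$ has radius of convergence at least $R$ (so that $\theta_j\equiv0$ is allowed), and that for some $\eta>0$ and $\varphi\in(0,\pi/2)$ both functions extend holomorphically to $$\varDelta_0=\bigl\{z\in\mathbb C:\ |z|<|R(1+\eta e^{i\varphi})|,\ z\ne R,\ |\arg(z-R)|>\varphi\bigr\}.$$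 Write $g_\kappa(R)=\lim_{r\uparrow R}g_\kappa(r)$ and $g_\kappa^{\{1\}}(R)=\lim_{r\uparrow R}r\,g_\kappa'(r)$. Assume that $g_\kappa^{\{1\}}(R)<1$ and that for some $\theta^*\ge0$, $\delta>0$, as $z\to R$ with $z\in\varDelta_0$, $$g_\theta(z)=-\theta^*\log(1-z/R)+O\bigl(|1-z/R|^{\delta}\bigr),$$ $$g_\kappa(z)=g_\kappa(R)-g_\kappa^{\{1\}}(R)\,(1-z/R)+O\bigl(|1-z/R|^{1+\delta}\bigr)$$ (principal branches of logarithms and powers throughout). (i) Let $f:\varDelta_0\to\mathbb C$ be holomorphic with, for some $\beta\ge0$, $$f(z)=(1-z/R)^{-\beta}\bigl\{1+O\bigl(|1-z/R|^{\delta}\bigr)\bigr\},\qquad z\to R,\ z\in\varDelta_0,$$ and let $0<v_1<1<v_2<1/g_\kappa^{\{1\}}(R)$. If $v\theta^*+\beta>0$ for all $v\in[v_1,v_2]$, then, uniformly in $v\in[v_1,v_2]$, as $N\to\infty$, $$[z^N]\bigl[f(z)\exp\{vG_N(z)\}\bigr]\sim\frac{\exp\{Nv\,g_\kappa(R)\}\,\bigl\{N\bigl(1-v\,g_\kappa^{\{1\}}(R)\bigr)\bigr\}^{v\theta^*+\beta-1}}{R^N\,\Gamma(v\theta^*+\beta)},$$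 that is, the ratio of the two sides tends to $1$ uniformly in $v\in[v_1,v_2]$. (ii) In particular, if $\theta^*>0$, then as $N\to\infty$ $$H_N\sim\frac{\exp\{N g_\kappa(R)\}\,\bigl\{N\bigl(1-g_\kappa^{\{1\}}(R)\bigr)\bigr\}^{\theta^*-1}}{R^N\,\Gamma(\theta^*)}.$$ -/

import Mathlib

open Filter Topology Asymptotics

noncomputable section

/-- The `j`-th coefficient `a_j / j` of the generating function of the sequence `(a_j)_{j ≥ 1}`.
It is `0` for `j = 0`, so that `a 0` plays no role. -/
def genCoeff (a : ℕ → ℝ) (j : ℕ) : ℂ := (a j : ℂ) / (j : ℂ)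

/-- The generating function `g_a(z) = ∑_{j ≥ 1} (a_j / j) z^j`. -/
def genFun (a : ℕ → ℝ) (z : ℂ) : ℂ := ∑' j : ℕ, genCoeff a j * z ^ j

/-- The radius of convergence of the power series `g_a`. -/
def genRadius (a : ℕ → ℝ) : ENNReal :=
  (FormalMultilinearSeries.ofScalars ℂ (genCoeff a)).radius

/-- The modified derivative `g^{n}(z) = z^n g⁽ⁿ⁾(z)`. -/
def modDeriv (n : ℕ) (g : ℂ → ℂ) (z : ℂ) : ℂ := z ^ n * iteratedDeriv n g z

/-- `G_N(z) = g_θ(z) + N g_κ(z)`. -/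
def bigG (θ κ : ℕ → ℝ) (N : ℕ) (z : ℂ) : ℂ := genFun θ z + (N : ℂ) * genFun κ z

/-- The coefficient `[z^n] F(z)` in the power series expansion at `0` of a function `F` that is
holomorphic near `0`. -/
def coeffAt (n : ℕ) (F : ℂ → ℂ) : ℂ := iteratedDeriv n F 0 / (n.factorial : ℂ)

/-- The open indented disc `Δ₀(R, η, φ)`. -/
def Delta0 (R η φ : ℝ) : Set ℂ :=
  {z : ℂ | ‖z‖ < ‖(R : ℂ) * (1 + (η : ℂ) * Complex.exp (Complex.I * (φ : ℂ)))‖ ∧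
    z ≠ (R : ℂ) ∧ φ < |Complex.arg (z - (R : ℂ))|}

/-- `(κ_j)_{j ≥ 1}` is non-arithmetic: no integer `j₀ > 1` divides all `j` with `κ_j ≠ 0`. -/
def NonArithmetic (κ : ℕ → ℝ) : Prop :=
  ¬ ∃ j₀ : ℕ, 1 < j₀ ∧ ∀ j : ℕ, 1 ≤ j → κ j ≠ 0 → j₀ ∣ j

/-- `(κ_j)_{j ≥ 1}` is non-degenerate: `κ_j > 0` for some `j ≥ 2`. -/
def NonDegenerate (κ : ℕ → ℝ) : Prop := ∃ j : ℕ, 2 ≤ j ∧ 0 < κ j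

/-- `g` is a holomorphic function on `Δ₀(R, η, φ)` which on the disc `|z| < R` is the sum of the
power series `g_a`; as `Δ₀` is connected, it is the analytic continuation of `g_a` to `Δ₀`. -/
def IsContinuation (a : ℕ → ℝ) (R η φ : ℝ) (g : ℂ → ℂ) : Prop :=
  DifferentiableOn ℂ g (Delta0 R η φ) ∧ ∀ z : ℂ, ‖z‖ < R → g z = genFun a z

/-- `C_j(σ)`: the number of cycles of length `j` of `σ` (fixed points are cycles of length `1`). -/
def cycleCount {N : ℕ} (σ : Equiv.Perm (Fin N)) (j : ℕ) : ℕ := σ.partition.parts.count j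

/-- `H_N = (1 / N!) ∑_{σ ∈ S_N} ∏_{j=1}^N (θ_j + N κ_j)^{C_j(σ)}`. -/
def partitionH (θ κ : ℕ → ℝ) (N : ℕ) : ℝ :=
  (1 / (N.factorial : ℝ)) * ∑ σ : Equiv.Perm (Fin N),
    ∏ j ∈ Finset.Icc 1 N, (θ j + (N : ℝ) * κ j) ^ cycleCount σ j

/-- The asserted leading term
`e^{N v K₀} {N (1 - v K₁)}^{vθ* + β - 1} / (R^N Γ(vθ* + β))`. -/
def leadingTerm (R K₀ K₁ θs β : ℝ) (N : ℕ) (v : ℝ) : ℝ :=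
  Real.exp ((N : ℝ) * v * K₀) * ((N : ℝ) * (1 - v * K₁)) ^ (v * θs + β - 1) /
    (R ^ N * Real.Gamma (v * θs + β))

end

/- Proof idea. Summing over cycle types turns `H_N` into `[z ^ N] exp G_N(z)`, the case `f = 1`,
`v = 1` of the uniform statement. After the factor `exp (N v g_κ(R))` has been removed,
`f exp (v G_N)` agrees near `z = R` with the model function `(z / R) ^ k (1 - z / R) ^ (-a)`, where
`a = v θ* + β` and `k = ⌊N v K₁⌋`. The coefficients of the model are quotients of Gamma functions,
whose asymptotics, uniform in `a`, follow from the log-convexity of `Γ`. The coefficient of the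
difference is a Cauchy integral, which in the coordinate `ζ = log (z / R)` is taken along two
slanted segments starting at distance `1 / N` to the left of the singularities `0` and `2πi`, and a
vertical segment joining them. On the slanted segments the singular expansions gain a factor
`|ζ| ^ δ`, and since `v K₁ < 1` the integrand decays like `exp (-c N Re ζ)`, so that the integral is
smaller than the coefficient of the model by a factor of order `N ^ (-δ)`. On the vertical segment
the integrand is exponentially small, because `Re g_κ < g_κ(R)` at all `z ≠ R` with `|z| = R` by
non-arithmeticity. -/

section ExponentialFormula

/-- The weight `∏ⱼ yⱼ ^ mⱼ / mⱼ!` of a multiset in which `j` has multiplicity `mⱼ`. -/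
noncomputable def multisetWeight {K : Type*} [Field K] (y : ℕ → K) (s : Multiset ℕ) : K :=
  (s.map y).prod / ((∏ j ∈ s.toFinset, (s.count j).factorial : ℕ) : K)

/-- The sum of the weights of all partitions of `n`, that is, the coefficient of `z ^ n` in
`exp (∑ⱼ yⱼ z ^ j)`. -/
noncomputable def partitionSum {K : Type*} [Field K] (y : ℕ → K) (n : ℕ) : K :=
  ∑ p : n.Partition, multisetWeight y p.parts

lemma prod_count_factorial_eq_of_subset {s : Multiset ℕ} {t : Finset ℕ} (h : s.toFinset ⊆ t) :
    ∏ j ∈ s.toFinset, (s.count j).factorial = ∏ j ∈ t, (s.count j).factorial :=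
  Finset.prod_subset h fun j _ hj => by
    rw [Multiset.count_eq_zero_of_notMem (mt Multiset.mem_toFinset.2 hj), Nat.factorial_zero]

lemma prod_count_factorial_cons (i : ℕ) (s : Multiset ℕ) :
    ∏ j ∈ (i ::ₘ s).toFinset, ((i ::ₘ s).count j).factorial =
      (s.count i + 1) * ∏ j ∈ s.toFinset, (s.count j).factorial := by
  have hi : i ∈ insert i s.toFinset := Finset.mem_insert_self _ _
  rw [prod_count_factorial_eq_of_subset (Finset.subset_insert i s.toFinset),
    Multiset.toFinset_cons, ← Finset.mul_prod_erase _ _ hi, ← Finset.mul_prod_erase _ _ hi,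
    Multiset.count_cons_self, Nat.factorial_succ, mul_assoc]
  congr 2
  exact Finset.prod_congr rfl fun j hj => by
    rw [Multiset.count_cons_of_ne (Finset.ne_of_mem_erase hj)]

lemma prod_count_factorial_filter_two_le {s : Multiset ℕ} (h0 : 0 ∉ s) :
    ∏ j ∈ s.toFinset, (s.count j).factorial =
      (s.count 1).factorial * ∏ j ∈ (s.filter (2 ≤ ·)).toFinset,
        ((s.filter (2 ≤ ·)).count j).factorial := by
  have hsub : s.toFinset ⊆ insert 1 (s.filter (2 ≤ ·)).toFinset := fun j hj => by
    have hj' : j ≠ 0 := fun h => h0 (h ▸ Multiset.mem_toFinset.1 hj)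
    simp only [Finset.mem_insert, Multiset.mem_toFinset, Multiset.mem_filter] at hj ⊢
    exact or_iff_not_imp_left.2 fun h1 => ⟨hj, by lia⟩
  rw [prod_count_factorial_eq_of_subset hsub, Finset.prod_insert (by simp)]
  congr 1
  refine Finset.prod_congr rfl fun j hj => ?_
  rw [Multiset.count_filter_of_pos (Multiset.mem_filter.1 (Multiset.mem_toFinset.1 hj)).2]

lemma eq_filter_two_le_add_replicate_one {s : Multiset ℕ} (h0 : 0 ∉ s) :
    s = s.filter (2 ≤ ·) + Multiset.replicate (s.count 1) 1 := by
  ext j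
  rw [Multiset.count_add, Multiset.count_filter, Multiset.count_replicate]
  match j with
  | 0 => simp [h0]
  | 1 => simp
  | j + 2 => simp

lemma card_filter_partition_mul {N : ℕ} (p : N.Partition) :
    (Finset.univ.filter fun σ : Equiv.Perm (Fin N) => σ.partition.parts = p.parts).card *
      (p.parts.prod * ∏ j ∈ p.parts.toFinset, (p.parts.count j).factorial) = N.factorial := by
  have h0 : 0 ∉ p.parts := fun h => (p.parts_pos h).ne rfl
  set m := p.parts.filter (2 ≤ ·) with hm
  have hparts : p.parts = m + Multiset.replicate (p.parts.count 1) 1 :=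
    eq_filter_two_le_add_replicate_one h0
  have hsum : m.sum + p.parts.count 1 = N := by
    simpa [p.parts_sum] using (congrArg Multiset.sum hparts).symm
  have hcount : p.parts.count 1 = N - m.sum := by lia
  have hprod : p.parts.prod = m.prod := by simpa using congrArg Multiset.prod hparts
  have hcycleType (σ : Equiv.Perm (Fin N)) : σ.partition.parts = p.parts ↔ σ.cycleType = m := by
    refine ⟨fun h => by rw [← Equiv.Perm.filter_parts_partition_eq_cycleType, h], fun h => ?_⟩
    rw [Equiv.Perm.parts_partition, ← Equiv.Perm.sum_cycleType, h, Fintype.card_fin,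
      ← hcount, ← hparts]
  have hcard := Equiv.Perm.card_of_cycleType_mul_eq (Fin N) m
  rw [Fintype.card_fin, if_pos ⟨by lia, fun a ha => (Multiset.mem_filter.1 ha).2⟩] at hcard
  simp_rw [hcycleType, prod_count_factorial_filter_two_le h0, ← hm, hprod, hcount]
  rw [← hcard]
  ring

lemma prod_cycleCount_eq_prod_map {M : Type*} [CommMonoid M] {N : ℕ} (x : ℕ → M)
    (σ : Equiv.Perm (Fin N)) :
    ∏ j ∈ Finset.Icc 1 N, x j ^ cycleCount σ j = (σ.partition.parts.map x).prod := by
  rw [Finset.prod_multiset_map_count]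
  symm
  refine Finset.prod_subset (fun j hj => ?_) fun j _ hj => ?_
  · have hj := Multiset.mem_toFinset.1 hj
    exact Finset.mem_Icc.2 ⟨σ.partition.parts_pos hj,
      (Multiset.le_sum_of_mem hj).trans_eq (σ.partition.parts_sum.trans (Fintype.card_fin N))⟩
  · rw [Multiset.count_eq_zero_of_notMem (mt Multiset.mem_toFinset.2 hj), pow_zero]

lemma partitionSum_zero {K : Type*} [Field K] (y : ℕ → K) : partitionSum y 0 = 1 := by
  simp [partitionSum, multisetWeight]

variable {K : Type*} [Field K] [CharZero K]

lemma multisetWeight_cons (y : ℕ → K) (i : ℕ) (s : Multiset ℕ) :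
    ((i ::ₘ s).count i : K) * multisetWeight y (i ::ₘ s) = y i * multisetWeight y s := by
  have hcount : (s.count i + 1 : K) ≠ 0 := mod_cast Nat.succ_ne_zero (s.count i)
  rw [multisetWeight, multisetWeight, prod_count_factorial_cons, Multiset.map_cons,
    Multiset.prod_cons, Multiset.count_cons_self]
  push_cast
  field_simp

lemma natCast_mul_multisetWeight (y : ℕ → K) (s : Multiset ℕ) :
    (s.sum : K) * multisetWeight y s =
      ∑ i ∈ s.toFinset, i * (y i * multisetWeight y (s.erase i)) := by
  rw [Finset.sum_multiset_count, Nat.cast_sum, Finset.sum_mul]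
  refine Finset.sum_congr rfl fun i hi => ?_
  have h := multisetWeight_cons y i (s.erase i)
  rw [Multiset.cons_erase (Multiset.mem_toFinset.1 hi)] at h
  rw [← h, smul_eq_mul, Nat.cast_mul]
  ring

/-- The partition of `n` obtained from a partition of `n - i` by adding the part `i`. -/
def insertPart {n i : ℕ} (hi : 0 < i) (hin : i ≤ n) (q : (n - i).Partition) : n.Partition where
  parts := i ::ₘ q.parts
  parts_pos hj := (Multiset.mem_cons.1 hj).elim (fun h => h ▸ hi) q.parts_pos
  parts_sum := by rw [Multiset.sum_cons, q.parts_sum, Nat.add_sub_cancel' hin]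

lemma sum_partition_erase {M : Type*} [AddCommMonoid M] (F : Multiset ℕ → M) {n i : ℕ}
    (hi : 0 < i) (hin : i ≤ n) :
    ∑ p : n.Partition with i ∈ p.parts, F (p.parts.erase i) =
      ∑ q : (n - i).Partition, F q.parts := by
  symm
  refine Finset.sum_bij (fun q _ => insertPart hi hin q) (fun q _ => ?_) (fun q _ r _ h => ?_)
    (fun p hp => ?_) (fun q _ => ?_)
  · simp [insertPart]
  · exact Nat.Partition.ext
      ((Multiset.cons_inj_right i).1 (congrArg Nat.Partition.parts h))
  · have hp : i ∈ p.parts := (Finset.mem_filter.1 hp).2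
    have hsum : (p.parts.erase i).sum = n - i := by
      have := Multiset.sum_erase hp
      have := p.parts_sum
      lia
    exact ⟨⟨p.parts.erase i, fun h => p.parts_pos (Multiset.mem_of_mem_erase h), hsum⟩,
      Finset.mem_univ _, Nat.Partition.ext (Multiset.cons_erase hp)⟩
  · simp [insertPart]

lemma natCast_mul_partitionSum (y : ℕ → K) (n : ℕ) :
    (n : K) * partitionSum y n = ∑ i ∈ Finset.Icc 1 n, i * (y i * partitionSum y (n - i)) := by
  have hmem (p : n.Partition) {i : ℕ} (hi : i ∈ p.parts) : i ∈ Finset.Icc 1 n :=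
    Finset.mem_Icc.2 ⟨p.parts_pos hi, p.parts_sum ▸ Multiset.le_sum_of_mem hi⟩
  calc (n : K) * partitionSum y n
      = ∑ p : n.Partition, ∑ i ∈ p.parts.toFinset,
          i * (y i * multisetWeight y (p.parts.erase i)) := by
        rw [partitionSum, Finset.mul_sum]
        refine Finset.sum_congr rfl fun p _ => ?_
        rw [← natCast_mul_multisetWeight, p.parts_sum]
    _ = ∑ i ∈ Finset.Icc 1 n, ∑ p : n.Partition with i ∈ p.parts,
          i * (y i * multisetWeight y (p.parts.erase i)) :=
        Finset.sum_comm' fun p i => by simpa using hmem p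
    _ = ∑ i ∈ Finset.Icc 1 n, i * (y i * partitionSum y (n - i)) := by
        refine Finset.sum_congr rfl fun i hi => ?_
        obtain ⟨hi, hin⟩ := Finset.mem_Icc.1 hi
        rw [← Finset.mul_sum, ← Finset.mul_sum, sum_partition_erase _ hi hin, partitionSum]

lemma sum_perm_prod_cycleCount (x : ℕ → K) (N : ℕ) :
    (N.factorial : K)⁻¹ * ∑ σ : Equiv.Perm (Fin N), ∏ j ∈ Finset.Icc 1 N, x j ^ cycleCount σ j =
      partitionSum (fun j => x j / j) N := by
  let shape (σ : Equiv.Perm (Fin N)) : N.Partition :=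
    ⟨σ.partition.parts, σ.partition.parts_pos, σ.partition.parts_sum.trans (Fintype.card_fin N)⟩
  have hshape (σ : Equiv.Perm (Fin N)) (p : N.Partition) :
      shape σ = p ↔ σ.partition.parts = p.parts := Nat.Partition.ext_iff
  simp_rw [prod_cycleCount_eq_prod_map]
  rw [← Finset.sum_fiberwise_of_maps_to (g := shape) fun σ _ => Finset.mem_univ _, Finset.mul_sum,
    partitionSum]
  refine Finset.sum_congr rfl fun p _ => ?_
  simp_rw [hshape]
  rw [Finset.sum_congr rfl fun σ hσ => by rw [(Finset.mem_filter.1 hσ).2], Finset.sum_const,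
    nsmul_eq_mul, multisetWeight, Multiset.prod_map_div, ← Nat.cast_multiset_prod,
    ← card_filter_partition_mul p]
  have : p.parts.prod ≠ 0 := Multiset.prod_ne_zero fun h => (p.parts_pos h).ne rfl
  have hcard := left_ne_zero_of_mul ((card_filter_partition_mul p).trans_ne N.factorial_ne_zero)
  push_cast
  field_simp

end ExponentialFormula

section Coefficients

variable {F G : ℂ → ℂ}

lemma coeffAt_eq_of_hasFPowerSeriesAt {c : ℕ → ℂ}
    (h : HasFPowerSeriesAt F (FormalMultilinearSeries.ofScalars ℂ c) 0) (n : ℕ) :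
    coeffAt n F = c n :=
  congrFun (FormalMultilinearSeries.ofScalars_series_injective ℂ ℂ
    (h.analyticAt.hasFPowerSeriesAt.eq_formalMultilinearSeries h)) n

lemma coeffAt_congr (h : F =ᶠ[𝓝 0] G) (n : ℕ) : coeffAt n F = coeffAt n G := by
  rw [coeffAt, coeffAt, h.iteratedDeriv_eq]

lemma coeffAt_add (hF : AnalyticAt ℂ F 0) (hG : AnalyticAt ℂ G 0) (n : ℕ) :
    coeffAt n (fun z => F z + G z) = coeffAt n F + coeffAt n G := by
  simp only [coeffAt, iteratedDeriv_fun_add hF.contDiffAt hG.contDiffAt, add_div]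

lemma coeffAt_const_mul (c : ℂ) (F : ℂ → ℂ) (n : ℕ) :
    coeffAt n (fun z => c * F z) = c * coeffAt n F := by
  simp only [coeffAt, iteratedDeriv_const_mul_field, mul_div_assoc]

lemma coeffAt_mul (hF : AnalyticAt ℂ F 0) (hG : AnalyticAt ℂ G 0) (n : ℕ) :
    coeffAt n (fun z => F z * G z)
      = ∑ k ∈ Finset.range (n + 1), coeffAt k F * coeffAt (n - k) G := by
  simp only [coeffAt]
  rw [iteratedDeriv_fun_mul hF.contDiffAt hG.contDiffAt, Finset.sum_div]
  refine Finset.sum_congr rfl fun k hk => ?_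
  rw [Nat.cast_choose ℂ (Finset.mem_range_succ_iff.1 hk)]
  have := Nat.cast_ne_zero (R := ℂ).2 n.factorial_ne_zero
  field_simp

lemma coeffAt_pow (k n : ℕ) : coeffAt n (fun z => z ^ k) = if n = k then 1 else 0 := by
  have hn := Nat.cast_ne_zero (R := ℂ).2 n.factorial_ne_zero
  rw [coeffAt, iteratedDeriv_fun_pow_zero]
  split_ifs with h
  · rw [← h, div_self hn]
  · rw [Nat.cast_zero, zero_div]

lemma coeffAt_pow_mul (hF : AnalyticAt ℂ F 0) (k n : ℕ) :
    coeffAt (n + k) (fun z => z ^ k * F z) = coeffAt n F := by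
  rw [coeffAt_mul (by fun_prop) hF, Finset.sum_eq_single k, coeffAt_pow, if_pos rfl, one_mul,
    Nat.add_sub_cancel]
  · intro j _ hj
    rw [coeffAt_pow, if_neg hj, zero_mul]
  · exact fun h => (h (Finset.mem_range.2 (by lia))).elim

lemma coeffAt_comp_div (hF : AnalyticAt ℂ F 0) (c : ℂ) (n : ℕ) :
    coeffAt n (fun z => F (z / c)) = coeffAt n F / c ^ n := by
  let u : ℂ →L[ℂ] ℂ := c⁻¹ • ContinuousLinearMap.id ℂ ℂ
  have hu (z : ℂ) : u z = z / c := by simp [u, div_eq_inv_mul]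
  have h := hF.hasFPowerSeriesAt
  rw [← map_zero u] at h
  replace h := h.compContinuousLinearMap (u := u) (x := 0)
  have hseries : (FormalMultilinearSeries.ofScalars ℂ
      fun n => iteratedDeriv n F (u 0) / (n.factorial : ℂ)).compContinuousLinearMap u
      = FormalMultilinearSeries.ofScalars ℂ fun n => coeffAt n F / c ^ n := by
    ext n
    simp [FormalMultilinearSeries.compContinuousLinearMap, coeffAt, u, div_eq_mul_inv]
    ring
  rw [hseries] at h
  simpa only [Function.comp_def, hu] using coeffAt_eq_of_hasFPowerSeriesAt h n

lemma coeffAt_deriv (F : ℂ → ℂ) (n : ℕ) :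
    coeffAt n (deriv F) = (n + 1) * coeffAt (n + 1) F := by
  have := Nat.cast_ne_zero (R := ℂ).2 n.factorial_ne_zero
  have : (n : ℂ) + 1 ≠ 0 := by exact_mod_cast n.succ_ne_zero
  rw [coeffAt, coeffAt, ← iteratedDeriv_succ', Nat.factorial_succ]
  push_cast
  field_simp

lemma coeffAt_exp_succ (hG : AnalyticAt ℂ G 0) (n : ℕ) :
    ((n : ℂ) + 1) * coeffAt (n + 1) (fun z => Complex.exp (G z))
      = ∑ k ∈ Finset.range (n + 1), ((k : ℂ) + 1) * coeffAt (k + 1) G *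
          coeffAt (n - k) (fun z => Complex.exp (G z)) := by
  have hderiv : deriv (fun z => Complex.exp (G z)) =ᶠ[𝓝 0]
      fun z => deriv G z * Complex.exp (G z) := by
    filter_upwards [hG.eventually_analyticAt] with z hz
    rw [hz.differentiableAt.hasDerivAt.cexp.deriv, mul_comm]
  simp only [← coeffAt_deriv]
  exact (coeffAt_congr hderiv n).trans (coeffAt_mul hG.deriv hG.cexp n)

lemma coeffAt_exp (hG : AnalyticAt ℂ G 0) (h0 : G 0 = 0) (n : ℕ) :
    coeffAt n (fun z => Complex.exp (G z)) = partitionSum (fun j => coeffAt j G) n := by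
  induction n using Nat.strong_induction_on with
  | _ n ih =>
    rcases n with _ | n
    · simp [coeffAt, partitionSum_zero, h0]
    · have hn : ((n + 1 : ℕ) : ℂ) ≠ 0 := Nat.cast_ne_zero.2 n.succ_ne_zero
      refine mul_left_cancel₀ hn ?_
      rw [natCast_mul_partitionSum, Nat.cast_succ, coeffAt_exp_succ hG, Finset.range_eq_Ico,
        show Finset.Icc 1 (n + 1) = Finset.Ico (0 + 1) (n + 1 + 1) from rfl,
        ← Finset.sum_Ico_add']
      refine Finset.sum_congr rfl fun k _ => ?_
      rw [ih (n - k) (by lia), Nat.add_sub_add_right, Nat.cast_succ, mul_assoc]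

end Coefficients

section GeneratingFunction

variable {θ κ : ℕ → ℝ}

lemma genFun_hasFPowerSeriesOnBall {a : ℕ → ℝ} (ha : 0 < genRadius a) :
    HasFPowerSeriesOnBall (genFun a) (FormalMultilinearSeries.ofScalars ℂ (genCoeff a)) 0
      (genRadius a) := by
  convert! (FormalMultilinearSeries.ofScalars ℂ (genCoeff a)).hasFPowerSeriesOnBall ha using 1
  ext z
  simp [FormalMultilinearSeries.sum, genFun, FormalMultilinearSeries.ofScalars]

lemma analyticAt_bigG (hθ : 0 < genRadius θ) (hκ : 0 < genRadius κ) (N : ℕ) :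
    AnalyticAt ℂ (bigG θ κ N) 0 :=
  (genFun_hasFPowerSeriesOnBall hθ).analyticAt.add
    (analyticAt_const.mul (genFun_hasFPowerSeriesOnBall hκ).analyticAt)

lemma coeffAt_bigG (hθ : 0 < genRadius θ) (hκ : 0 < genRadius κ) (N n : ℕ) :
    coeffAt n (bigG θ κ N) = ((θ n + N * κ n : ℝ) : ℂ) / n := by
  have h := (genFun_hasFPowerSeriesOnBall hθ).hasFPowerSeriesAt.add
    ((genFun_hasFPowerSeriesOnBall hκ).hasFPowerSeriesAt.const_smul (c := (N : ℂ)))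
  rw [← FormalMultilinearSeries.ofScalars_smul, ← FormalMultilinearSeries.ofScalars_add] at h
  refine (coeffAt_eq_of_hasFPowerSeriesAt h n).trans ?_
  simp only [genCoeff, Pi.add_apply, Pi.smul_apply, smul_eq_mul]
  push_cast
  ring

lemma partitionH_eq_coeffAt (hθ : 0 < genRadius θ) (hκ : 0 < genRadius κ) (N : ℕ) :
    (partitionH θ κ N : ℂ) = coeffAt N fun z => Complex.exp (bigG θ κ N z) := by
  have h0 : bigG θ κ N 0 = 0 := by simpa [coeffAt] using coeffAt_bigG hθ hκ N 0
  simp_rw [coeffAt_exp (analyticAt_bigG hθ hκ N) h0, coeffAt_bigG hθ hκ,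
    ← sum_perm_prod_cycleCount, partitionH, one_div]
  push_cast
  rfl

end GeneratingFunction

section GammaRatio

/-- The logarithm of `Γ(n + a) / (n! n ^ (a - 1))`: a convex function of `a ≥ 0` that vanishes at
`0` and at `1`. -/
noncomputable def logGammaRatio (n : ℕ) (a : ℝ) : ℝ :=
  Real.log (Real.Gamma (n + a)) - Real.log n.factorial - (a - 1) * Real.log n

variable {n : ℕ}

lemma exp_logGammaRatio (hn : 0 < n) {a : ℝ} (ha : 0 ≤ a) :
    Real.exp (logGammaRatio n a) = Real.Gamma (n + a) / n.factorial / (n : ℝ) ^ (a - 1) := by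
  have hn' : (0 : ℝ) < n := Nat.cast_pos.2 hn
  rw [logGammaRatio, Real.exp_sub, Real.exp_sub,
    Real.exp_log (Real.Gamma_pos_of_pos (by positivity)), Real.exp_log (by positivity),
    Real.rpow_def_of_pos hn', mul_comm (Real.log n)]

lemma convexOn_logGammaRatio (hn : 0 < n) : ConvexOn ℝ (Set.Ici 0) (logGammaRatio n) := by
  have : (0 : ℝ) < n := Nat.cast_pos.2 hn
  have hGamma : ConvexOn ℝ (Set.Ici 0) fun a : ℝ => Real.log (Real.Gamma (n + a)) :=
    (Real.convexOn_log_Gamma.translate_right (n : ℝ)).subset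
      (fun a (ha : 0 ≤ a) => show (0 : ℝ) < n + a by positivity) (convex_Ici 0)
  have haffine : ConvexOn ℝ (Set.Ici 0) fun a : ℝ =>
      -Real.log n * a + (Real.log n - Real.log n.factorial) := by
    refine ⟨convex_Ici 0, fun x _ y _ s t _ _ hst => le_of_eq ?_⟩
    rw [← eq_sub_iff_add_eq'] at hst
    simp only [smul_eq_mul, hst]
    ring
  refine (hGamma.add haffine).congr fun a _ => ?_
  simp only [logGammaRatio, Pi.add_apply]
  ring

lemma logGammaRatio_zero (hn : 0 < n) : logGammaRatio n 0 = 0 := by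
  have hn' : (0 : ℝ) < n := Nat.cast_pos.2 hn
  rw [logGammaRatio, ← Real.Gamma_nat_eq_factorial, Real.Gamma_add_one hn'.ne',
    Real.log_mul hn'.ne' (Real.Gamma_pos_of_pos hn').ne', add_zero]
  ring

lemma logGammaRatio_one : logGammaRatio n 1 = 0 := by
  rw [logGammaRatio, Real.Gamma_nat_eq_factorial]
  ring

lemma logGammaRatio_add_one (hn : 0 < n) {a : ℝ} (ha : 0 ≤ a) :
    logGammaRatio n (a + 1) = logGammaRatio n a + Real.log (1 + a / n) := by
  have hn' : (0 : ℝ) < n := Nat.cast_pos.2 hn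
  have hna : 0 < n + a := by positivity
  rw [show 1 + a / n = (n + a) / n by field_simp, Real.log_div hna.ne' hn'.ne', logGammaRatio,
    logGammaRatio, ← add_assoc, Real.Gamma_add_one hna.ne',
    Real.log_mul hna.ne' (Real.Gamma_pos_of_pos hna).ne']
  ring

lemma tendsto_logGammaRatio_nat (k : ℕ) :
    Tendsto (fun n : ℕ => logGammaRatio n k) atTop (𝓝 0) := by
  induction k with
  | zero =>
    refine tendsto_const_nhds.congr' ?_
    filter_upwards [eventually_gt_atTop 0] with n hn
    rw [Nat.cast_zero, logGammaRatio_zero hn]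
  | succ k ih =>
    have hlog : Tendsto (fun n : ℕ => Real.log (1 + k / (n : ℝ))) atTop (𝓝 0) := by
      simpa using ((tendsto_const_div_atTop_nhds_zero_nat (k : ℝ)).const_add 1).log (by norm_num)
    have hsum := ih.add hlog
    rw [add_zero] at hsum
    refine hsum.congr' ?_
    filter_upwards [eventually_gt_atTop 0] with n hn
    rw [Nat.cast_succ, logGammaRatio_add_one hn k.cast_nonneg]

lemma abs_le_of_convexOn_of_zero_of_one {g : ℝ → ℝ} (hg : ConvexOn ℝ (Set.Ici 0) g)
    (h0 : g 0 = 0) (h1 : g 1 = 0) {a M : ℝ} (hM : 2 ≤ M) (ha : a ∈ Set.Icc 0 M) :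
    |g a| ≤ g M := by
  have nonneg_of_one_le {x : ℝ} (hx : 1 ≤ x) : 0 ≤ g x := by
    have hx0 : (0 : ℝ) < x := by linarith
    by_contra! hneg
    have := hg.2 (Set.mem_Ici.2 le_rfl) (Set.mem_Ici.2 hx0.le)
      (sub_nonneg.2 (inv_le_one_of_one_le₀ hx)) (inv_nonneg.2 hx0.le) (by ring)
    simp only [smul_eq_mul, mul_zero, zero_add, inv_mul_cancel₀ hx0.ne', h0, h1] at this
    nlinarith [inv_pos.2 hx0]
  have le_of_mem {x : ℝ} (hx : x ∈ Set.Icc 0 M) : g x ≤ g M := by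
    have := hg.le_max_of_mem_Icc (Set.mem_Ici.2 le_rfl)
      (Set.mem_Ici.2 (by linarith : (0 : ℝ) ≤ M)) hx
    rwa [h0, max_eq_right (nonneg_of_one_le (by linarith))] at this
  refine abs_le'.2 ⟨le_of_mem ha, ?_⟩
  rcases le_or_gt 1 a with ha1 | ha1
  · linarith [nonneg_of_one_le ha1, nonneg_of_one_le (by linarith : 1 ≤ M)]
  · have hpos : 0 < 2 - a := by linarith
    have := hg.2 (Set.mem_Ici.2 ha.1) (Set.mem_Ici.2 zero_le_two)
      (div_nonneg zero_le_one hpos.le) (div_nonneg (sub_nonneg.2 ha1.le) hpos.le)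
      (by field_simp; ring)
    rw [smul_eq_mul, smul_eq_mul, smul_eq_mul, smul_eq_mul,
      show 1 / (2 - a) * a + (1 - a) / (2 - a) * 2 = 1 by field_simp; ring, h1] at this
    have hle : 0 ≤ g a + (1 - a) * g 2 := by
      rw [show 1 / (2 - a) * g a + (1 - a) / (2 - a) * g 2 = (g a + (1 - a) * g 2) / (2 - a) by
        ring] at this
      simpa using (le_div_iff₀ hpos).1 this
    nlinarith [le_of_mem ⟨zero_le_two, hM⟩, nonneg_of_one_le one_le_two, ha.1]

variable {ι : Type*} {l : Filter ι} {n : ι → ℕ} {a : ι → ℝ} {M : ℝ}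

lemma tendsto_logGammaRatio (hn : Tendsto n l atTop) (ha : ∀ᶠ i in l, a i ∈ Set.Icc 0 M) :
    Tendsto (fun i => logGammaRatio (n i) (a i)) l (𝓝 0) := by
  obtain ⟨k, hk⟩ := exists_nat_ge (max M 2)
  refine squeeze_zero_norm' ?_ ((tendsto_logGammaRatio_nat k).comp hn)
  filter_upwards [ha, hn.eventually_gt_atTop 0] with i hai hni
  exact abs_le_of_convexOn_of_zero_of_one (convexOn_logGammaRatio hni) (logGammaRatio_zero hni)
    logGammaRatio_one ((le_max_right M 2).trans hk)
    ⟨hai.1, hai.2.trans ((le_max_left M 2).trans hk)⟩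

lemma tendsto_Gamma_add_div_factorial {m : ι → ℝ} (hn : Tendsto n l atTop)
    (ha : ∀ᶠ i in l, a i ∈ Set.Icc 0 M) (hm : Tendsto (fun i => m i / n i) l (𝓝 1)) :
    Tendsto (fun i => Real.Gamma (n i + a i) / (n i).factorial / m i ^ (a i - 1)) l (𝓝 1) := by
  have hbdd : IsBoundedUnder (· ≤ ·) l fun i => ‖a i - 1‖ :=
    isBoundedUnder_of_eventually_le (a := |M| + 1) <| ha.mono fun i hi => by
      rw [Real.norm_eq_abs, abs_le]
      constructor <;> linarith [hi.1, hi.2, le_abs_self M, abs_nonneg M]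
  have hlog : Tendsto (fun i => Real.log (m i / n i)) l (𝓝 0) := by
    simpa using hm.log one_ne_zero
  have hexp := ((tendsto_logGammaRatio hn ha).sub (hlog.zero_mul_isBoundedUnder_le hbdd)).rexp
  rw [sub_zero, Real.exp_zero] at hexp
  refine hexp.congr' ?_
  filter_upwards [ha, hn.eventually_gt_atTop 0, hm.eventually (lt_mem_nhds one_pos)]
    with i hai hni hmi
  have hni' : (0 : ℝ) < n i := Nat.cast_pos.2 hni
  have hmi' : 0 < m i := (div_pos_iff_of_pos_right hni').1 hmi
  have := Real.rpow_pos_of_pos hni' (a i - 1)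
  have := Real.rpow_pos_of_pos hmi' (a i - 1)
  rw [Real.exp_sub, exp_logGammaRatio hni hai.1, ← Real.rpow_def_of_pos hmi,
    Real.div_rpow hmi'.le hni'.le]
  field_simp

end GammaRatio

section BinomialCoefficients

lemma analyticAt_one_sub_cpow (a : ℂ) : AnalyticAt ℂ (fun z : ℂ => (1 - z) ^ a) 0 :=
  (analyticAt_const.sub analyticAt_id).cpow analyticAt_const (by simp)

lemma choose_add_sub_one_eq_Gamma {a : ℝ} (ha : 0 < a) (n : ℕ) :
    Ring.choose ((a : ℂ) + n - 1) n
      = ((Real.Gamma (n + a) / n.factorial / Real.Gamma a : ℝ) : ℂ) := by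
  have hne (k : ℕ) : (a : ℂ) ≠ -k := fun h => by
    have := congrArg Complex.re h
    simp only [Complex.ofReal_re, Complex.neg_re, Complex.natCast_re] at this
    linarith [k.cast_nonneg (α := ℝ)]
  have h := Ring.factorial_nsmul_multichoose_eq_ascPochhammer (a : ℂ) n
  rw [Polynomial.ascPochhammer_smeval_eq_eval, ← Complex.Gamma_add_nat_div_Gamma_eq (a : ℂ) hne,
    nsmul_eq_mul, add_comm, ← Complex.ofReal_natCast n, ← Complex.ofReal_add, Complex.Gamma_ofReal,
    Complex.Gamma_ofReal] at h
  have := Nat.cast_ne_zero (R := ℂ).2 n.factorial_ne_zero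
  rw [← Ring.multichoose_eq]
  push_cast at h ⊢
  rw [div_right_comm, ← h]
  field_simp

lemma coeffAt_one_sub_cpow {a : ℝ} (ha : 0 < a) (n : ℕ) :
    coeffAt n (fun z : ℂ => (1 - z) ^ (-(a : ℂ)))
      = ((Real.Gamma (n + a) / n.factorial / Real.Gamma a : ℝ) : ℂ) := by
  have h := (Complex.one_div_one_sub_cpow_hasFPowerSeriesOnBall_zero (a : ℂ)).hasFPowerSeriesAt
  simpa only [Complex.cpow_neg, one_div, choose_add_sub_one_eq_Gamma ha]
    using coeffAt_eq_of_hasFPowerSeriesAt h n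

/-- The function `(z / R) ^ k (1 - z / R) ^ (-a)`, with explicit coefficients, to which
`f(z) exp (v G_N(z)) exp (-N v K₀)` is compared near `z = R`; with `k ≈ N v K₁` both have the same
logarithmic derivative to leading order. -/
noncomputable def model (R : ℝ) (k : ℕ) (a : ℝ) (z : ℂ) : ℂ :=
  (z / R) ^ k * (1 - z / R) ^ (-(a : ℂ))

lemma analyticAt_model (R : ℝ) (k : ℕ) (a : ℝ) : AnalyticAt ℂ (model R k a) 0 := by
  have h : AnalyticAt ℂ (fun z : ℂ => z / (R : ℂ)) 0 := by fun_prop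
  exact (h.pow k).mul ((analyticAt_const.sub h).cpow analyticAt_const (by simp))

lemma coeffAt_model (R : ℝ) {a : ℝ} (ha : 0 < a) (k n : ℕ) :
    coeffAt (n + k) (model R k a)
      = ((Real.Gamma (n + a) / n.factorial / Real.Gamma a / R ^ (n + k) : ℝ) : ℂ) := by
  have hanalytic := analyticAt_one_sub_cpow (-(a : ℂ))
  have hpow : AnalyticAt ℂ (fun z : ℂ => z ^ k) 0 := by fun_prop
  refine (coeffAt_comp_div (hpow.mul hanalytic) (R : ℂ) (n + k)).trans ?_
  rw [show ((fun z : ℂ => z ^ k) * fun z : ℂ => (1 - z) ^ (-(a : ℂ))) =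
    fun z => z ^ k * (1 - z) ^ (-(a : ℂ)) from rfl, coeffAt_pow_mul hanalytic,
    coeffAt_one_sub_cpow ha]
  push_cast
  rfl

end BinomialCoefficients

section IndentedDisc

lemma lt_abs_arg_of_re_lt {u : ℂ} {φ : ℝ} (hφ : φ < Real.pi / 2)
    (h : u.re * Real.sin φ < |u.im| * Real.cos φ) : φ < |u.arg| := by
  by_contra! hle
  have hsin : |u.im| = ‖u‖ * Real.sin |u.arg| := by
    rw [← Complex.norm_mul_sin_arg u, abs_mul, abs_norm,
      Real.abs_sin_eq_sin_abs_of_abs_le_pi (Complex.abs_arg_le_pi u)]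
  have hcos : u.re = ‖u‖ * Real.cos |u.arg| := by
    rw [Real.cos_abs, Complex.norm_mul_cos_arg]
  have hdiff : 0 ≤ Real.sin (φ - |u.arg|) :=
    Real.sin_nonneg_of_nonneg_of_le_pi (by linarith) (by linarith [abs_nonneg u.arg, Real.pi_pos])
  rw [Real.sin_sub] at hdiff
  rw [hsin, hcos] at h
  nlinarith [norm_nonneg u]

variable {R η φ : ℝ}

lemma lt_norm_mul_one_add_exp (hR : 0 < R) (hη : 0 < η) (hφ : 0 < φ) (hφ' : φ < Real.pi / 2) :
    R < ‖(R : ℂ) * (1 + (η : ℂ) * Complex.exp (Complex.I * (φ : ℂ)))‖ := by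
  have hcos : 0 < Real.cos φ := Real.cos_pos_of_mem_Ioo ⟨by linarith, hφ'⟩
  have hre : ((R : ℂ) * (1 + (η : ℂ) * Complex.exp (Complex.I * (φ : ℂ)))).re
      = R + R * (η * Real.cos φ) := by
    rw [Complex.re_ofReal_mul, Complex.add_re, Complex.re_ofReal_mul, mul_comm Complex.I,
      Complex.exp_ofReal_mul_I_re, Complex.one_re]
    ring
  exact (lt_add_of_pos_right R (by positivity)).trans_le (hre ▸ Complex.re_le_norm _)

lemma ball_subset_Delta0 (hR : 0 < R) (hη : 0 < η) (hφ : 0 < φ) (hφ' : φ < Real.pi / 2) :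
    Metric.ball 0 R ⊆ Delta0 R η φ := by
  intro z hz
  rw [mem_ball_zero_iff] at hz
  have hcos : 0 < Real.cos φ := Real.cos_pos_of_mem_Ioo ⟨by linarith, hφ'⟩
  have hsin : 0 < Real.sin φ := Real.sin_pos_of_pos_of_lt_pi hφ (by linarith)
  have hre : (z - R).re < 0 := by
    rw [Complex.sub_re, Complex.ofReal_re]
    linarith [Complex.re_le_norm z]
  refine ⟨hz.trans (lt_norm_mul_one_add_exp hR hη hφ hφ'), ?_, lt_abs_arg_of_re_lt hφ' ?_⟩
  · rintro rfl
    simp at hre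
  · exact (mul_neg_of_neg_of_pos hre hsin).trans_le (by positivity)

/-- A strip to the left of a wedge with apex `0`. In the coordinate `z = R e ^ ζ` it covers the
part of an indented disc near the closed disc `|z| ≤ R`, once around the origin. -/
def logSector (lam s : ℝ) : Set ℂ :=
  {ζ : ℂ | ζ.re < s ∧ ζ.re < lam * |ζ.im| ∧ |ζ.im| ≤ Real.pi}

lemma cos_sub_exp_neg_mul_sin_lt (hφ : 0 < φ) (hφ' : φ < Real.pi / 2) {x y : ℝ}
    (hy : |y| ≤ Real.pi) (hxy : x < 2 / Real.pi * (Real.cos φ / Real.sin φ) * |y|) :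
    (Real.cos y - Real.exp (-x)) * Real.sin φ < Real.sin |y| * Real.cos φ := by
  have hcos : 0 < Real.cos φ := Real.cos_pos_of_mem_Ioo ⟨by linarith, hφ'⟩
  have hsin : 0 < Real.sin φ := Real.sin_pos_of_pos_of_lt_pi hφ (by linarith)
  rcases lt_or_ge (Real.pi / 2) |y| with hlarge | hsmall
  · have hcosy : Real.cos y < 0 := by
      rw [← Real.cos_abs]
      exact Real.cos_neg_of_pi_div_two_lt_of_lt hlarge (by linarith)
    have hsiny : 0 ≤ Real.sin |y| := Real.sin_nonneg_of_nonneg_of_le_pi (abs_nonneg y) hy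
    exact (mul_neg_of_neg_of_pos (by linarith [Real.exp_pos (-x)]) hsin).trans_le (by positivity)
  · calc (Real.cos y - Real.exp (-x)) * Real.sin φ
        ≤ x * Real.sin φ := by
          gcongr
          linarith [Real.cos_le_one y, Real.add_one_le_exp (-x)]
      _ < 2 / Real.pi * (Real.cos φ / Real.sin φ) * |y| * Real.sin φ := by gcongr
      _ = 2 / Real.pi * |y| * Real.cos φ := by field_simp
      _ ≤ Real.sin |y| * Real.cos φ := by
          gcongr
          exact Real.mul_le_sin (abs_nonneg y) hsmall

lemma lt_abs_arg_mul_exp_sub (hR : 0 < R) (hφ : 0 < φ) (hφ' : φ < Real.pi / 2) {ζ : ℂ}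
    (him : |ζ.im| ≤ Real.pi)
    (hζ : ζ.re < 2 / Real.pi * (Real.cos φ / Real.sin φ) * |ζ.im|) :
    φ < |(R * Complex.exp ζ - R : ℂ).arg| := by
  apply lt_abs_arg_of_re_lt hφ'
  have hreal : (R * Complex.exp ζ - R : ℂ).re =
      R * Real.exp ζ.re * (Real.cos ζ.im - Real.exp (-ζ.re)) := by
    rw [Complex.sub_re, Complex.re_ofReal_mul, Complex.exp_re, Complex.ofReal_re, Real.exp_neg]
    field_simp
  have himag : |(R * Complex.exp ζ - R : ℂ).im| = R * Real.exp ζ.re * Real.sin |ζ.im| := by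
    rw [Complex.sub_im, Complex.im_ofReal_mul, Complex.exp_im, Complex.ofReal_im, sub_zero,
      abs_mul, abs_mul, abs_of_pos hR, Real.abs_exp, Real.abs_sin_eq_sin_abs_of_abs_le_pi him,
      mul_assoc]
  rw [hreal, himag, mul_assoc _ (_ - _), mul_assoc _ (Real.sin _)]
  exact mul_lt_mul_of_pos_left (cos_sub_exp_neg_mul_sin_lt hφ hφ' him hζ) (by positivity)

lemma norm_mul_exp (hR : 0 < R) (ζ : ℂ) : ‖(R : ℂ) * Complex.exp ζ‖ = R * Real.exp ζ.re := by
  rw [norm_mul, Complex.norm_exp, Complex.norm_real, Real.norm_of_nonneg hR.le]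

lemma mul_exp_mem_ball (hR : 0 < R) {ζ : ℂ} (hζ : ζ.re < 0) :
    (R : ℂ) * Complex.exp ζ ∈ Metric.ball 0 R := by
  rw [mem_ball_zero_iff, norm_mul_exp hR]
  exact mul_lt_of_lt_one_right hR (Real.exp_lt_one_iff.2 hζ)

lemma exists_logSector_mapsTo_Delta0 (hR : 0 < R) (hη : 0 < η) (hφ : 0 < φ)
    (hφ' : φ < Real.pi / 2) : ∃ lam s : ℝ, 0 < lam ∧ 0 < s ∧
      Set.MapsTo (fun ζ : ℂ => R * Complex.exp ζ) (logSector lam s) (Delta0 R η φ) := by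
  have hcos : 0 < Real.cos φ := Real.cos_pos_of_mem_Ioo ⟨by linarith, hφ'⟩
  have hsin : 0 < Real.sin φ := Real.sin_pos_of_pos_of_lt_pi hφ (by linarith)
  have hρ := lt_norm_mul_one_add_exp hR hη hφ hφ'
  set ρ := ‖(R : ℂ) * (1 + (η : ℂ) * Complex.exp (Complex.I * (φ : ℂ)))‖
  refine ⟨2 / Real.pi * (Real.cos φ / Real.sin φ), Real.log (ρ / R), by positivity,
    Real.log_pos ((one_lt_div hR).2 hρ), fun ζ ⟨hs, hlam, hπ⟩ => ?_⟩
  have harg := lt_abs_arg_mul_exp_sub hR hφ hφ' hπ hlam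
  refine ⟨?_, ?_, harg⟩
  · rw [Real.lt_log_iff_exp_lt (div_pos (hR.trans hρ) hR), lt_div_iff₀' hR] at hs
    exact (norm_mul_exp hR ζ).trans_lt hs
  · intro heq
    simp only [heq, sub_self, Complex.arg_zero, abs_zero] at harg
    exact hφ.not_gt harg

lemma logSector_subset_logSector {lam lam' s s' : ℝ} (hlam : lam ≤ lam') (hs : s ≤ s') :
    logSector lam s ⊆ logSector lam' s' := fun ζ ⟨hre, hwedge, him⟩ =>
  ⟨hre.trans_le hs, hwedge.trans_le (by gcongr), him⟩

end IndentedDisc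

section ContourEstimate

lemma norm_sub_le_of_norm_le_exp {P Φ : ℂ → ℂ} {W : Set ℂ} (hW : Convex ℝ W)
    (hP : ∀ ζ ∈ W, HasDerivAt P (Φ ζ) ζ) {p q : ℂ} (hp : p ∈ W) (hq : q ∈ W) {M γ : ℝ}
    (hγ : 0 < γ)
    (hΦ : ∀ t ∈ Set.Icc (0 : ℝ) 1, ‖Φ (AffineMap.lineMap p q t)‖ ≤ M * Real.exp (-(γ * t))) :
    ‖P q - P p‖ ≤ ‖q - p‖ * (M / γ) := by
  have hpath : ∀ t ∈ Set.Icc (0 : ℝ) 1, HasDerivAt (fun t : ℝ => P (AffineMap.lineMap p q t) - P p)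
      ((q - p) * Φ (AffineMap.lineMap p q t)) t := fun t ht =>
    ((hP _ (hW.lineMap_mem hp hq ht)).scomp t AffineMap.hasDerivAt_lineMap).sub_const _
  have hbound : ∀ t : ℝ, HasDerivAt
      (fun t => ‖q - p‖ * (M / γ) * (1 - Real.exp (-(γ * t))))
      (‖q - p‖ * (M * Real.exp (-(γ * t)))) t := fun t => by
    have hexp : HasDerivAt (fun t => Real.exp (-(γ * t))) (Real.exp (-(γ * t)) * -γ) t := by
      simpa using ((hasDerivAt_id' t).const_mul γ).fun_neg.exp
    refine ((hexp.const_sub 1).const_mul (‖q - p‖ * (M / γ))).congr_deriv ?_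
    field_simp
  have hle := image_norm_le_of_norm_deriv_right_le_deriv_boundary
    (f := fun t : ℝ => P (AffineMap.lineMap p q t) - P p)
    (fun t ht => (hpath t ht).continuousAt.continuousWithinAt)
    (fun t ht => (hpath t ⟨ht.1, ht.2.le⟩).hasDerivWithinAt) (by simp) hbound
    (fun t ht => (norm_mul_le _ _).trans (by gcongr; exact hΦ t ⟨ht.1, ht.2.le⟩))
    (Set.right_mem_Icc.2 zero_le_one)
  have hM : 0 ≤ M := by
    simpa using (norm_nonneg _).trans (hΦ 0 (Set.left_mem_Icc.2 zero_le_one))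
  rw [AffineMap.lineMap_apply_one] at hle
  refine hle.trans (mul_le_of_le_one_right (by positivity) ?_)
  linarith [Real.exp_pos (-(γ * 1))]

/-- The integrand of Cauchy's formula for the `N`-th coefficient of `H`, in the coordinate
`z = R e ^ ζ`. -/
noncomputable def cauchyIntegrand (R : ℝ) (N : ℕ) (H : ℂ → ℂ) (ζ : ℂ) : ℂ :=
  H (R * Complex.exp ζ) * Complex.exp (-(N * ζ))

lemma cauchyIntegrand_periodic (R : ℝ) (N : ℕ) (H : ℂ → ℂ) :
    Function.Periodic (cauchyIntegrand R N H) (2 * Real.pi * Complex.I) := by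
  intro ζ
  have hexp : Complex.exp (-(N * (ζ + 2 * Real.pi * Complex.I))) = Complex.exp (-(N * ζ)) := by
    rw [mul_add, neg_add, ← sub_eq_add_neg, Complex.exp_periodic.sub_nat_mul_eq]
  rw [cauchyIntegrand, cauchyIntegrand, Complex.exp_periodic, hexp]

/-- The strip to the left of two wedges with apexes `0` and `2πi`: in contrast to `logSector`, it
is convex. -/
def wedgeStrip (lam s : ℝ) : Set ℂ :=
  {ζ : ℂ | ζ.re < s ∧ ζ.re < lam * ζ.im ∧ ζ.re < lam * (2 * Real.pi - ζ.im)}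

lemma convex_wedgeStrip (lam s : ℝ) : Convex ℝ (wedgeStrip lam s) := by
  have hlower : IsLinearMap ℝ fun ζ : ℂ => ζ.re - lam * ζ.im :=
    (Complex.reLm - lam • Complex.imLm).isLinear
  have hupper : IsLinearMap ℝ fun ζ : ℂ => ζ.re + lam * ζ.im :=
    (Complex.reLm + lam • Complex.imLm).isLinear
  convert (convex_halfSpace_re_lt s).inter ((convex_halfSpace_lt hlower 0).inter
    (convex_halfSpace_lt hupper (lam * (2 * Real.pi)))) using 1
  ext ζ
  simp only [wedgeStrip, Set.mem_ofPred_eq, Set.mem_inter_iff, sub_lt_zero, mul_sub,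
    lt_sub_iff_add_lt]

lemma isOpen_wedgeStrip (lam s : ℝ) : IsOpen (wedgeStrip lam s) := by
  have hre := Complex.continuous_re
  have := Complex.continuous_im
  exact (isOpen_lt hre (by fun_prop)).inter ((isOpen_lt hre (by fun_prop)).inter
    (isOpen_lt hre (by fun_prop)))

lemma conj_add_two_pi_I_mem_wedgeStrip {lam s : ℝ} {ζ : ℂ} (hζ : ζ ∈ wedgeStrip lam s) :
    (starRingEnd ℂ) ζ + 2 * Real.pi * Complex.I ∈ wedgeStrip lam s := by
  obtain ⟨hs, hlower, hupper⟩ := hζ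
  refine ⟨?_, ?_, ?_⟩ <;> simp <;> linarith

variable {R lam s : ℝ} {D : Set ℂ} {H : ℂ → ℂ} {N : ℕ}

lemma mapsTo_wedgeStrip (hR : 0 < R) (hlam : 0 < lam) (hball : Metric.ball 0 R ⊆ D)
    (hD : Set.MapsTo (fun ζ : ℂ => R * Complex.exp ζ) (logSector lam s) D) :
    Set.MapsTo (fun ζ : ℂ => R * Complex.exp ζ) (wedgeStrip lam s) D := by
  rintro ζ ⟨hs, hlower, hupper⟩
  rcases lt_or_ge ζ.re 0 with hneg | hnonneg
  · exact hball (mul_exp_mem_ball hR hneg)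
  have him : 0 < ζ.im := pos_of_mul_pos_right (hnonneg.trans_lt hlower) hlam.le
  have him' : 0 < 2 * Real.pi - ζ.im := pos_of_mul_pos_right (hnonneg.trans_lt hupper) hlam.le
  rcases le_total ζ.im Real.pi with hπ | hπ
  · exact hD ⟨hs, by rwa [abs_of_pos him], by rwa [abs_of_pos him]⟩
  · have habs : |(ζ - 2 * Real.pi * Complex.I).im| = 2 * Real.pi - ζ.im := by
      rw [← abs_of_pos him', abs_sub_comm]
      simp
    have hmem : ζ - 2 * Real.pi * Complex.I ∈ logSector lam s :=
      ⟨by simpa using hs, by rw [habs]; simpa using hupper, by rw [habs]; linarith⟩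
    simpa only [Complex.exp_periodic.sub_eq] using hD hmem

lemma exists_primitive_cauchyIntegrand
    (hD : Set.MapsTo (fun ζ : ℂ => R * Complex.exp ζ) (wedgeStrip lam s) D)
    (hH : DifferentiableOn ℂ H D) (N : ℕ) :
    ∃ P : ℂ → ℂ, ∀ ζ ∈ wedgeStrip lam s, HasDerivAt P (cauchyIntegrand R N H ζ) ζ := by
  have hdiff : DifferentiableOn ℂ (cauchyIntegrand R N H) (wedgeStrip lam s) :=
    (hH.comp (by fun_prop) hD).mul (by fun_prop)
  obtain ⟨P, hP⟩ := (convex_wedgeStrip lam s).exists_forall_hasDerivWithinAt hdiff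
  exact ⟨P, fun ζ hζ => (hP ζ hζ).hasDerivAt ((isOpen_wedgeStrip lam s).mem_nhds hζ)⟩

lemma integral_cauchyIntegrand (hR : 0 < R) (hH : DifferentiableOn ℂ H (Metric.ball 0 R)) {ε : ℝ}
    (hε : 0 < ε) (N : ℕ) :
    ∫ y in (0 : ℝ)..2 * Real.pi, cauchyIntegrand R N H (-ε + y * Complex.I) =
      2 * Real.pi * (coeffAt N H * R ^ N) := by
  set r : ℝ := R * Real.exp (-ε) with hr
  have hr0 : 0 < r := by positivity
  have hrR : r < R := mul_lt_of_lt_one_right hR (Real.exp_lt_one_iff.2 (by linarith))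
  have hR0 : (R : ℂ) ≠ 0 := Complex.ofReal_ne_zero.2 hR.ne'
  have hcauchy := ((hH.mono (Metric.closedBall_subset_ball hrR)).diffContOnCl_ball
    subset_rfl).circleIntegral_one_div_sub_center_pow_smul hr0 N
  have hcircle : ∀ y : ℝ, circleMap 0 r y = R * Complex.exp (-ε + y * Complex.I) := fun y => by
    rw [circleMap, zero_add, hr, Complex.exp_add]
    push_cast
    ring
  have hintegrand : ∀ y : ℝ, deriv (circleMap 0 r) y • (1 / (circleMap 0 r y - 0) ^ (N + 1)) •
      H (circleMap 0 r y) = Complex.I / R ^ N * cauchyIntegrand R N H (-ε + y * Complex.I) := by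
    intro y
    have hE := Complex.exp_ne_zero (-ε + y * Complex.I)
    rw [deriv_circleMap, sub_zero, hcircle, cauchyIntegrand, Complex.exp_neg, Complex.exp_nat_mul,
      smul_eq_mul, smul_eq_mul]
    field_simp
    ring
  simp_rw [circleIntegral, hintegrand] at hcauchy
  rw [intervalIntegral.integral_const_mul, smul_eq_mul] at hcauchy
  rw [coeffAt]
  field_simp at hcauchy ⊢
  linear_combination hcauchy

lemma primitive_cauchyIntegrand_sub (hR : 0 < R) (hlam : 0 < lam) (hs : 0 < s)
    (hH : DifferentiableOn ℂ H (Metric.ball 0 R)) {P : ℂ → ℂ}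
    (hP : ∀ ζ ∈ wedgeStrip lam s, HasDerivAt P (cauchyIntegrand R N H ζ) ζ) {ε : ℝ}
    (hε : 0 < ε) :
    P (-ε + 2 * Real.pi * Complex.I) - P (-ε) =
      2 * Real.pi * Complex.I * (coeffAt N H * R ^ N) := by
  have hmem : ∀ y ∈ Set.uIcc 0 (2 * Real.pi), -ε + y * Complex.I ∈ wedgeStrip lam s := by
    intro y hy
    rw [Set.uIcc_of_le (by positivity)] at hy
    have hlower := mul_nonneg hlam.le hy.1
    have hupper := mul_nonneg hlam.le (sub_nonneg.2 hy.2)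
    refine ⟨?_, ?_, ?_⟩ <;> simp <;> linarith
  have hderiv : ∀ y ∈ Set.uIcc 0 (2 * Real.pi), HasDerivAt (fun y : ℝ => P (-ε + y * Complex.I))
      (Complex.I * cauchyIntegrand R N H (-ε + y * Complex.I)) y := fun y hy => by
    have hline : HasDerivAt (fun y : ℝ => -(ε : ℂ) + y * Complex.I) Complex.I y := by
      simpa using ((hasDerivAt_id y).ofReal_comp.mul_const Complex.I).const_add (-(ε : ℂ))
    exact (hP _ (hmem y hy)).scomp y hline
  have hcont : Continuous fun y : ℝ => cauchyIntegrand R N H (-ε + y * Complex.I) :=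
    (hH.continuousOn.comp_continuous (by fun_prop)
      fun y => mul_exp_mem_ball hR (by simpa using hε)).mul (by fun_prop)
  have hFTC := intervalIntegral.integral_eq_sub_of_hasDerivAt hderiv
    ((continuous_const.mul hcont).intervalIntegrable _ _)
  rw [intervalIntegral.integral_const_mul, integral_cauchyIntegrand hR hH hε] at hFTC
  push_cast at hFTC
  rw [zero_mul, add_zero] at hFTC
  rw [← hFTC]
  ring

lemma norm_cauchyIntegrand_le_of_mem_segment {w : ℂ} (hw0 : 0 ≤ w.im) (hwπ : w.im ≤ Real.pi)
    {M : ℝ} (hvertical : ∀ ζ : ℂ, ζ.re = w.re → w.im ≤ |ζ.im| → |ζ.im| ≤ Real.pi →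
      ‖cauchyIntegrand R N H ζ‖ ≤ M) {ζ : ℂ}
    (hζ : ζ ∈ segment ℝ w ((starRingEnd ℂ) w + 2 * Real.pi * Complex.I)) :
    ‖cauchyIntegrand R N H ζ‖ ≤ M := by
  obtain ⟨t, ht, rfl⟩ := (segment_eq_image_lineMap ℝ _ _).subset hζ
  set ζ := AffineMap.lineMap w ((starRingEnd ℂ) w + 2 * Real.pi * Complex.I) t with hζ_def
  have hre : ζ.re = w.re := by
    simp [hζ_def, AffineMap.lineMap_apply]
  have him : ζ.im = w.im + t * (2 * (Real.pi - w.im)) := by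
    simp [hζ_def, AffineMap.lineMap_apply]
    ring
  have hlower : w.im ≤ ζ.im := by
    rw [him]
    exact le_add_of_nonneg_right (mul_nonneg ht.1 (by linarith))
  have hupper : ζ.im ≤ 2 * Real.pi - w.im := by
    linarith [mul_le_of_le_one_left (show 0 ≤ 2 * (Real.pi - w.im) by linarith) ht.2]
  rcases le_total ζ.im Real.pi with hπ | hπ
  · exact hvertical ζ hre (hlower.trans (le_abs_self _)) (abs_le.2 ⟨by linarith, hπ⟩)
  · have him' : (ζ - 2 * Real.pi * Complex.I).im = ζ.im - 2 * Real.pi := by simp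
    rw [← (cauchyIntegrand_periodic R N H).sub_eq]
    refine hvertical _ (by simpa using hre) ?_ ?_ <;> rw [him']
    · exact le_abs.2 (Or.inr (by linarith))
    · exact abs_le.2 ⟨by linarith, by linarith⟩

lemma cauchyIntegrand_lineMap_add_two_pi_I (p q : ℂ) (t : ℝ) :
    cauchyIntegrand R N H (AffineMap.lineMap (p + 2 * Real.pi * Complex.I)
      (q + 2 * Real.pi * Complex.I) t) = cauchyIntegrand R N H (AffineMap.lineMap p q t) := by
  rw [← cauchyIntegrand_periodic R N H (AffineMap.lineMap p q t)]
  simp only [AffineMap.lineMap_apply, vsub_eq_sub, vadd_eq_add, add_sub_add_right_eq_sub, add_assoc]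

lemma norm_conj_add_two_pi_I_sub_le {w : ℂ} (hw0 : 0 ≤ w.im) (hwπ : w.im ≤ Real.pi) :
    ‖(starRingEnd ℂ) w + 2 * Real.pi * Complex.I - w‖ ≤ 2 * Real.pi := by
  have hdiff : (starRingEnd ℂ) w + 2 * Real.pi * Complex.I - w =
      ((2 * (Real.pi - w.im) : ℝ) : ℂ) * Complex.I := by
    apply Complex.ext <;> simp
    ring
  rw [hdiff, norm_mul, Complex.norm_I, Complex.norm_real, mul_one,
    Real.norm_of_nonneg (by linarith)]
  linarith

/-- The contour runs from `-ε` along a slanted segment to `w`, then vertically, and back along the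
mirrored slanted segment to `-ε + 2πi`. -/
lemma norm_coeffAt_mul_pow_le (hR : 0 < R) (hlam : 0 < lam) (hs : 0 < s)
    (hball : Metric.ball 0 R ⊆ D)
    (hD : Set.MapsTo (fun ζ : ℂ => R * Complex.exp ζ) (logSector lam s) D)
    (hH : DifferentiableOn ℂ H D) {w : ℂ} (hw : w ∈ wedgeStrip lam s) (hw0 : 0 ≤ w.im)
    (hwπ : w.im ≤ Real.pi) {ε M M' γ : ℝ} (hε : 0 < ε) (hγ : 0 < γ)
    (hslanted : ∀ ω : ℂ, ω = w ∨ ω = (starRingEnd ℂ) w → ∀ t ∈ Set.Icc (0 : ℝ) 1,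
      ‖cauchyIntegrand R N H (AffineMap.lineMap (-ε : ℂ) ω t)‖ ≤ M * Real.exp (-(γ * t)))
    (hvertical : ∀ ζ : ℂ, ζ.re = w.re → w.im ≤ |ζ.im| → |ζ.im| ≤ Real.pi →
      ‖cauchyIntegrand R N H ζ‖ ≤ M') :
    ‖coeffAt N H‖ * R ^ N ≤ ‖w + ε‖ * (M / γ) + M' := by
  set T : ℂ := 2 * Real.pi * Complex.I
  have hconvex := convex_wedgeStrip lam s
  have hε_mem : (-ε : ℂ) ∈ wedgeStrip lam s := by
    refine ⟨?_, ?_, ?_⟩ <;> simp <;> linarith [mul_pos hlam Real.pi_pos]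
  have hε_mem' : (-ε : ℂ) + T ∈ wedgeStrip lam s := by
    simpa using conj_add_two_pi_I_mem_wedgeStrip hε_mem
  have hw' := conj_add_two_pi_I_mem_wedgeStrip hw
  obtain ⟨P, hP⟩ := exists_primitive_cauchyIntegrand (mapsTo_wedgeStrip hR hlam hball hD) hH N
  have hfirst : ‖P w - P (-ε)‖ ≤ ‖w + ε‖ * (M / γ) := by
    simpa using norm_sub_le_of_norm_le_exp hconvex hP hε_mem hw hγ (hslanted w (Or.inl rfl))
  have hsecond : ‖P ((starRingEnd ℂ) w + T) - P w‖ ≤ M' * (2 * Real.pi) := by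
    have hM' : 0 ≤ M' :=
      (norm_nonneg _).trans (hvertical w rfl (le_abs_self _) (by rwa [abs_of_nonneg hw0]))
    exact ((convex_segment w _).norm_image_sub_le_of_norm_hasDerivWithin_le
      (fun ζ hζ => (hP ζ (hconvex.segment_subset hw hw' hζ)).hasDerivWithinAt)
      (fun ζ hζ => norm_cauchyIntegrand_le_of_mem_segment hw0 hwπ hvertical hζ)
      (left_mem_segment ℝ _ _) (right_mem_segment ℝ _ _)).trans
      (mul_le_mul_of_nonneg_left (norm_conj_add_two_pi_I_sub_le hw0 hwπ) hM')
  have hthird : ‖P ((starRingEnd ℂ) w + T) - P (-ε + T)‖ ≤ ‖w + ε‖ * (M / γ) := by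
    have hlength : ‖(starRingEnd ℂ) w + T - (-ε + T)‖ = ‖w + ε‖ := by
      rw [← Complex.norm_conj (w + ε)]
      simp
    rw [← hlength]
    refine norm_sub_le_of_norm_le_exp hconvex hP hε_mem' hw' hγ fun t ht => ?_
    rw [cauchyIntegrand_lineMap_add_two_pi_I]
    exact hslanted _ (Or.inr rfl) t ht
  have hcoeff : 2 * Real.pi * (‖coeffAt N H‖ * R ^ N) = ‖P (-ε + T) - P (-ε)‖ := by
    rw [primitive_cauchyIntegrand_sub hR hlam hs (hH.mono hball) hP hε]
    simp [abs_of_pos Real.pi_pos, abs_of_pos hR]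
  have htriangle : ‖P (-ε + T) - P (-ε)‖ ≤
      ‖w + ε‖ * (M / γ) + M' * (2 * Real.pi) + ‖w + ε‖ * (M / γ) := by
    rw [show P (-ε + T) - P (-ε) = P w - P (-ε) + (P ((starRingEnd ℂ) w + T) - P w) -
      (P ((starRingEnd ℂ) w + T) - P (-ε + T)) by ring]
    exact norm_sub_le_of_le (norm_add_le_of_le hfirst hsecond) hthird
  have hslanted_nonneg : 0 ≤ ‖w + ε‖ * (M / γ) := (norm_nonneg _).trans hfirst
  nlinarith [Real.pi_gt_three]

end ContourEstimate

section Positivity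

variable {κ : ℕ → ℝ} {R K₀ K₁ : ℝ}

lemma hasSum_genFun (hR : ENNReal.ofReal R ≤ genRadius κ) {z : ℂ} (hz : ‖z‖ < R) :
    HasSum (fun j => genCoeff κ j * z ^ j) (genFun κ z) := by
  have hz' : (‖z‖₊ : ENNReal) < genRadius κ := by
    refine lt_of_lt_of_le ?_ hR
    rw [ENNReal.lt_ofReal_iff_toReal_lt (by simp)]
    simpa using hz
  have h := (genFun_hasFPowerSeriesOnBall (zero_le.trans_lt hz')).hasSum (y := z)
    (by simpa [enorm_eq_nnnorm] using hz')
  simpa [mul_comm] using h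

lemma mul_pow_sub_re_le_genFun_sub (hκ : ∀ j : ℕ, 1 ≤ j → 0 ≤ κ j)
    (hR : ENNReal.ofReal R ≤ genRadius κ) {z : ℂ} {r : ℝ} (hzr : ‖z‖ ≤ r) (hr : r < R) (j : ℕ) :
    κ j / j * (r ^ j - (z ^ j).re) ≤ (genFun κ (r : ℂ)).re - (genFun κ z).re := by
  have hr0 : 0 ≤ r := (norm_nonneg z).trans hzr
  have hr' : ‖(r : ℂ)‖ < R := by rwa [Complex.norm_real, Real.norm_of_nonneg hr0]
  have hsum := (Complex.hasSum_re (hasSum_genFun hR hr')).sub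
    (Complex.hasSum_re (hasSum_genFun hR (hzr.trans_lt hr)))
  have hterm : ∀ i, (genCoeff κ i * (r : ℂ) ^ i).re - (genCoeff κ i * z ^ i).re =
      κ i / i * (r ^ i - (z ^ i).re) := fun i => by
    rw [show genCoeff κ i = ((κ i / i : ℝ) : ℂ) by simp [genCoeff], Complex.re_ofReal_mul,
      Complex.re_ofReal_mul, ← Complex.ofReal_pow, Complex.ofReal_re]
    ring
  simp_rw [hterm] at hsum
  refine le_hasSum hsum j fun i _ => ?_
  have hcoeff : 0 ≤ κ i / i := by
    rcases Nat.eq_zero_or_pos i with rfl | hi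
    · simp
    · exact div_nonneg (hκ i hi) i.cast_nonneg
  refine mul_nonneg hcoeff (sub_nonneg.2 ((Complex.re_le_norm _).trans ?_))
  rw [norm_pow]
  gcongr

lemma modDeriv_genFun_re_nonneg (hκ : ∀ j : ℕ, 1 ≤ j → 0 ≤ κ j)
    (hR : ENNReal.ofReal R ≤ genRadius κ) {r : ℝ} (hr : r ∈ Set.Ioo 0 R) :
    0 ≤ (modDeriv 1 (genFun κ) r).re := by
  have hmono : MonotoneOn (fun r : ℝ => (genFun κ r).re) (Set.Ioo 0 R) := by
    intro x hx y hy hxy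
    have hx' : ‖(x : ℂ)‖ ≤ y := by rwa [Complex.norm_real, Real.norm_of_nonneg hx.1.le]
    have hle := mul_pow_sub_re_le_genFun_sub hκ hR hx' hy.2 0
    rw [Nat.cast_zero, div_zero, zero_mul] at hle
    exact sub_nonneg.1 hle
  have hball : (r : ℂ) ∈ Metric.eball 0 (genRadius κ) := by
    refine Metric.eball_subset_eball hR ?_
    rw [Metric.eball_ofReal, mem_ball_zero_iff, Complex.norm_real, Real.norm_of_nonneg hr.1.le]
    exact hr.2
  have hpos : 0 < genRadius κ := (ENNReal.ofReal_pos.2 (hr.1.trans hr.2)).trans_le hR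
  have hderiv : HasDerivAt (fun r : ℝ => (genFun κ r).re) (deriv (genFun κ) r).re r :=
    ((genFun_hasFPowerSeriesOnBall hpos).analyticAt_of_mem
      hball).differentiableAt.hasDerivAt.real_of_complex
  have hnonneg : 0 ≤ (deriv (genFun κ) r).re := by
    rw [← hderiv.deriv, ← derivWithin_of_mem_nhds (Ioo_mem_nhds hr.1 hr.2)]
    exact hmono.derivWithin_nonneg
  rw [modDeriv, pow_one, iteratedDeriv_one, Complex.re_ofReal_mul]
  exact mul_nonneg hr.1.le hnonneg

lemma nonneg_of_tendsto_modDeriv (hκ : ∀ j : ℕ, 1 ≤ j → 0 ≤ κ j) (hR0 : 0 < R)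
    (hR : ENNReal.ofReal R ≤ genRadius κ)
    (hK₁ : Tendsto (fun r : ℝ => modDeriv 1 (genFun κ) (r : ℂ)) (𝓝[<] R) (𝓝 (K₁ : ℂ))) :
    0 ≤ K₁ := by
  refine ge_of_tendsto ((Complex.continuous_re.tendsto _).comp hK₁) ?_
  filter_upwards [Ioo_mem_nhdsLT hR0] with r hr
  exact modDeriv_genFun_re_nonneg hκ hR hr

lemma mul_pow_sub_re_le_of_norm_lt (hκ : ∀ j : ℕ, 1 ≤ j → 0 ≤ κ j)
    (hR : ENNReal.ofReal R ≤ genRadius κ)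
    (hK₀ : Tendsto (fun r : ℝ => genFun κ (r : ℂ)) (𝓝[<] R) (𝓝 (K₀ : ℂ)))
    {z : ℂ} (hz : ‖z‖ < R) (j : ℕ) :
    κ j / j * (R ^ j - (z ^ j).re) ≤ K₀ - (genFun κ z).re := by
  have hleft : Tendsto (fun r : ℝ => κ j / j * (r ^ j - (z ^ j).re)) (𝓝[<] R)
      (𝓝 (κ j / j * (R ^ j - (z ^ j).re))) :=
    (Continuous.tendsto (by fun_prop) R).mono_left nhdsWithin_le_nhds
  have hright : Tendsto (fun r : ℝ => (genFun κ (r : ℂ)).re - (genFun κ z).re) (𝓝[<] R)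
      (𝓝 (K₀ - (genFun κ z).re)) :=
    ((Complex.continuous_re.tendsto _).comp hK₀).sub_const _
  refine le_of_tendsto_of_tendsto hleft hright ?_
  filter_upwards [Ioo_mem_nhdsLT hz] with r hr
  exact mul_pow_sub_re_le_genFun_sub hκ hR hr.1.le hr.2 j

variable {η φ : ℝ} {g : ℂ → ℂ}

lemma mul_pow_sub_re_le_of_norm_le (hκ : ∀ j : ℕ, 1 ≤ j → 0 ≤ κ j) (hR0 : 0 < R)
    (hR : ENNReal.ofReal R ≤ genRadius κ) (hball : Metric.ball 0 R ⊆ Delta0 R η φ)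
    (hg : IsContinuation κ R η φ g)
    (hK₀ : Tendsto (fun r : ℝ => genFun κ (r : ℂ)) (𝓝[<] R) (𝓝 (K₀ : ℂ)))
    {z : ℂ} (hz : ‖z‖ ≤ R) (hzD : z ∈ Delta0 R η φ) (j : ℕ) :
    κ j / j * (R ^ j - (z ^ j).re) ≤ K₀ - (g z).re := by
  have hclosure : z ∈ closure (Metric.ball 0 R) := by
    rwa [closure_ball _ hR0.ne', mem_closedBall_zero_iff]
  have hcont : ContinuousWithinAt g (Metric.ball 0 R) z :=
    (hg.1.continuousOn z hzD).mono hball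
  refine ContinuousWithinAt.closure_le (f := fun z : ℂ => κ j / j * (R ^ j - (z ^ j).re))
    (g := fun z => K₀ - (g z).re) hclosure (Continuous.continuousWithinAt (by fun_prop))
    (continuousWithinAt_const.sub
      (Complex.continuous_re.continuousAt.comp_continuousWithinAt hcont))
    fun y hy => ?_
  rw [mem_ball_zero_iff] at hy
  rw [hg.2 y hy]
  exact mul_pow_sub_re_le_of_norm_lt hκ hR hK₀ hy j

lemma re_continuation_le (hκ : ∀ j : ℕ, 1 ≤ j → 0 ≤ κ j) (hR : ENNReal.ofReal R ≤ genRadius κ)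
    (hg : IsContinuation κ R η φ g)
    (hK₀ : Tendsto (fun r : ℝ => genFun κ (r : ℂ)) (𝓝[<] R) (𝓝 (K₀ : ℂ)))
    {z : ℂ} (hz : ‖z‖ < R) : (g z).re ≤ K₀ := by
  have hle := mul_pow_sub_re_le_of_norm_lt hκ hR hK₀ hz 0
  rw [Nat.cast_zero, div_zero, zero_mul] at hle
  rw [hg.2 z hz]
  exact sub_nonneg.1 hle

lemma exists_pow_ne_one (hκ : ∀ j : ℕ, 1 ≤ j → 0 ≤ κ j) (hNA : NonArithmetic κ)
    (hND : NonDegenerate κ) {u : ℂ} (hu : u ≠ 1) : ∃ j : ℕ, 1 ≤ j ∧ 0 < κ j ∧ u ^ j ≠ 1 := by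
  by_contra! hall
  obtain ⟨i, hi2, hi⟩ := hND
  have hpos : 0 < orderOf u :=
    Nat.pos_of_dvd_of_pos (orderOf_dvd_of_pow_eq_one (hall i (by omega) hi)) (by omega)
  have hne : orderOf u ≠ 1 := fun h => hu (orderOf_eq_one_iff.1 h)
  exact hNA ⟨orderOf u, by omega, fun j hj hκj =>
    orderOf_dvd_of_pow_eq_one (hall j hj ((hκ j hj).lt_of_ne' hκj))⟩

open scoped ComplexOrder in
lemma re_lt_of_norm_eq_of_ne {z : ℂ} {r : ℝ} (hz : ‖z‖ = r) (hne : z ≠ r) : z.re < r := by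
  refine (hz ▸ Complex.re_le_norm z).lt_of_ne fun hre => hne ?_
  rw [← hz] at hre ⊢
  exact Complex.eq_coe_norm_of_nonneg (Complex.re_eq_norm.1 hre)

lemma re_continuation_lt (hκ : ∀ j : ℕ, 1 ≤ j → 0 ≤ κ j) (hNA : NonArithmetic κ)
    (hND : NonDegenerate κ) (hR0 : 0 < R) (hR : ENNReal.ofReal R ≤ genRadius κ)
    (hball : Metric.ball 0 R ⊆ Delta0 R η φ) (hg : IsContinuation κ R η φ g)
    (hK₀ : Tendsto (fun r : ℝ => genFun κ (r : ℂ)) (𝓝[<] R) (𝓝 (K₀ : ℂ)))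
    {z : ℂ} (hz : ‖z‖ = R) (hzD : z ∈ Delta0 R η φ) : (g z).re < K₀ := by
  have hRne : (R : ℂ) ≠ 0 := Complex.ofReal_ne_zero.2 hR0.ne'
  obtain ⟨j, hj, hκj, hne⟩ := exists_pow_ne_one hκ hNA hND
    (u := z / R) (mt (div_eq_one_iff_eq hRne).1 hzD.2.1)
  rw [div_pow, ne_eq, div_eq_one_iff_eq (pow_ne_zero j hRne), ← Complex.ofReal_pow] at hne
  have hlt := re_lt_of_norm_eq_of_ne (by rw [norm_pow, hz]) hne
  have hpos : 0 < κ j / j * (R ^ j - (z ^ j).re) :=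
    mul_pos (div_pos hκj (Nat.cast_pos.2 hj)) (sub_pos.2 hlt)
  linarith [mul_pow_sub_re_le_of_norm_le hκ hR0 hR hball hg hK₀ hz.le hzD j]

end Positivity

section GrowthAcrossImaginaryAxis

variable {q : ℂ → ℂ} {lam s ε : ℝ}

lemma ball_im_mul_I_subset_logSector (hlam : 0 < lam) {y : ℝ} (hy : y ≠ 0) (hys : 2 * |y| ≤ s)
    (hyπ : 2 * |y| ≤ Real.pi) :
    Metric.ball (y * Complex.I) (lam / (1 + lam) * |y|) ⊆ logSector lam s := by
  intro ω hω
  have hy' : 0 < |y| := abs_pos.2 hy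
  have hc : lam / (1 + lam) * |y| = lam * (|y| - lam / (1 + lam) * |y|) := by
    field_simp
    ring
  have hc1 : lam / (1 + lam) * |y| < |y| :=
    mul_lt_of_lt_one_left hy' ((div_lt_one (by linarith)).2 (by linarith))
  rw [mem_ball_iff_norm] at hω
  have hre : ω.re < lam / (1 + lam) * |y| := by
    simpa using (Complex.re_le_norm _).trans_lt hω
  have him : |ω.im - y| < lam / (1 + lam) * |y| := by
    simpa using (Complex.abs_im_le_norm _).trans_lt hω
  have him_lower : |y| - lam / (1 + lam) * |y| < |ω.im| := by
    linarith [abs_sub_abs_le_abs_sub y ω.im, abs_sub_comm y ω.im]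
  have him_upper : |ω.im| < 2 * |y| := by
    linarith [abs_sub_abs_le_abs_sub ω.im y]
  refine ⟨by linarith, ?_, by linarith⟩
  calc ω.re < lam * (|y| - lam / (1 + lam) * |y|) := hc ▸ hre
    _ ≤ lam * |ω.im| := by gcongr

lemma norm_sub_imaginary_le (hlam : 0 < lam) (hq : DifferentiableOn ℂ q (logSector lam s))
    {ζ : ℂ} {c : ℝ} (hc : 0 ≤ c) (hζ : ζ ∈ logSector (lam / (1 + lam)) s) (hre : 0 ≤ ζ.re)
    (hs : 2 * |ζ.im| ≤ s) (hπ : 2 * |ζ.im| ≤ Real.pi)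
    (hsmall : ∀ ω ∈ logSector lam s, ‖ω‖ ≤ 2 * |ζ.im| → ‖q ω‖ ≤ c * ‖ω‖) :
    ‖q ζ - q (ζ.im * Complex.I)‖ ≤ 4 * c * ((1 + lam) / lam) * ζ.re := by
  set y := ζ.im
  have hy : 0 < |y| := pos_of_mul_pos_right (hre.trans_lt hζ.2.1) (by positivity)
  have hball := ball_im_mul_I_subset_logSector hlam (abs_pos.1 hy) hs hπ
  have hdist : dist ζ (y * Complex.I) = ζ.re := by
    rw [dist_eq_norm, ← Complex.re_add_im ζ, add_sub_cancel_right, Complex.norm_real,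
      Complex.re_add_im, Real.norm_of_nonneg hre]
  have hbound : ∀ ω ∈ Metric.ball (y * Complex.I) (lam / (1 + lam) * |y|),
      ‖q ω‖ ≤ c * (2 * |y|) := by
    intro ω hω
    have hω' : ‖ω‖ ≤ 2 * |y| := by
      have hc1 : lam / (1 + lam) * |y| ≤ |y| :=
        mul_le_of_le_one_left hy.le ((div_le_one (by linarith)).2 (by linarith))
      have hnorm : ‖(y : ℂ) * Complex.I‖ = |y| := by simp
      linarith [norm_le_norm_add_norm_sub' ω (y * Complex.I), mem_ball_iff_norm.1 hω]
    exact (hsmall ω (hball hω) hω').trans (by gcongr)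
  have hmaps : Set.MapsTo q (Metric.ball (y * Complex.I) (lam / (1 + lam) * |y|))
      (Metric.closedBall (q (y * Complex.I)) (4 * c * |y|)) := by
    intro ω hω
    rw [mem_closedBall_iff_norm]
    linarith [norm_sub_le (q ω) (q (y * Complex.I)), hbound ω hω,
      hbound _ (Metric.mem_ball_self (by positivity))]
  have hschwarz := Complex.dist_le_div_mul_dist_of_mapsTo_ball (hq.mono hball) hmaps
    (by rw [Metric.mem_ball, hdist]; exact hζ.2.1)
  rw [hdist, dist_eq_norm] at hschwarz
  refine hschwarz.trans_eq ?_
  field_simp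

lemma exists_forall_re_le_of_isLittleO (hlam : 0 < lam) (hs : 0 < s)
    (hq : DifferentiableOn ℂ q (logSector lam s)) (hsmall : q =o[𝓝[logSector lam s] 0] id)
    (hneg : ∀ y : ℝ, y ≠ 0 → |y| ≤ Real.pi → (q (y * Complex.I)).re ≤ 0) (hε : 0 < ε) :
    ∃ r > 0, ∀ ζ ∈ logSector (lam / (1 + lam)) s, 0 ≤ ζ.re → |ζ.im| < r →
      (q ζ).re ≤ ε * ζ.re := by
  set c : ℝ := ε * (lam / (1 + lam)) / 4
  have hc : 0 < c := by positivity
  obtain ⟨r, hr, hball⟩ := Metric.mem_nhdsWithin_iff.1 (hsmall.bound hc)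
  refine ⟨min (r / 2) (min (s / 2) (Real.pi / 2)), by positivity, fun ζ hζ hre him => ?_⟩
  obtain ⟨himr, hims, himπ⟩ : |ζ.im| < r / 2 ∧ |ζ.im| < s / 2 ∧ |ζ.im| < Real.pi / 2 := by
    simpa only [lt_min_iff] using him
  have hle := norm_sub_imaginary_le hlam hq hc.le hζ hre (by linarith) (by linarith)
    fun ω hω hωr => hball ⟨mem_ball_zero_iff.2 (by linarith), hω⟩
  have him0 : 0 < |ζ.im| := pos_of_mul_pos_right (hre.trans_lt hζ.2.1) (by positivity)
  calc (q ζ).re = (q ζ - q (ζ.im * Complex.I)).re + (q (ζ.im * Complex.I)).re := by simp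
    _ ≤ 4 * c * ((1 + lam) / lam) * ζ.re + 0 :=
      add_le_add ((Complex.re_le_norm _).trans hle) (hneg _ (abs_pos.1 him0) hζ.2.2)
    _ = ε * ζ.re := by
      simp only [c]
      field_simp
      ring

lemma exists_forall_re_le_of_le_abs_im (hlam : 0 < lam) (hs : 0 < s)
    (hq : ContinuousOn q (logSector lam s))
    (hneg : ∀ y : ℝ, y ≠ 0 → |y| ≤ Real.pi → (q (y * Complex.I)).re < 0) {r : ℝ} (hr : 0 < r) :
    ∃ s' > 0, ∀ ζ : ℂ, 0 ≤ ζ.re → ζ.re < s' → r ≤ |ζ.im| → |ζ.im| ≤ Real.pi → (q ζ).re ≤ 0 := by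
  set K : Set ℝ := {y : ℝ | r ≤ |y| ∧ |y| ≤ Real.pi}
  have hK : IsCompact K :=
    (isCompact_Icc (a := -Real.pi) (b := Real.pi)).of_isClosed_subset
      ((isClosed_le continuous_const continuous_abs).inter
        (isClosed_le continuous_abs continuous_const)) fun y hy => abs_le.1 hy.2
  have hlocal : ∀ y ∈ K, ∀ᶠ p : ℝ × ℝ in 𝓝 (0, y),
      |p.2| ≤ Real.pi → (q (p.1 + p.2 * Complex.I)).re < 0 := by
    intro y hy
    have hy0 : 0 < |y| := hr.trans_le hy.1
    have hmem : (y * Complex.I : ℂ) ∈ logSector lam s :=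
      ⟨by simpa using hs, by simpa using mul_pos hlam hy0, by simpa using hy.2⟩
    have hnhds : ∀ᶠ ω in 𝓝 (y * Complex.I), ω ∈ logSector lam s → (q ω).re < 0 :=
      eventually_nhdsWithin_iff.1 ((Complex.continuous_re.continuousAt.comp_continuousWithinAt
        (hq _ hmem)).eventually_lt_const (hneg y (abs_pos.1 hy0) hy.2))
    have hpath : Tendsto (fun p : ℝ × ℝ => (p.1 + p.2 * Complex.I : ℂ)) (𝓝 (0, y))
        (𝓝 (y * Complex.I)) := by
      have hcont : Continuous fun p : ℝ × ℝ => (p.1 + p.2 * Complex.I : ℂ) := by fun_prop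
      simpa using hcont.tendsto (0, y)
    have hwedge : ∀ᶠ p : ℝ × ℝ in 𝓝 (0, y), p.1 < lam * |p.2| :=
      continuousAt_fst.eventually_lt (by fun_prop) (by simpa using mul_pos hlam hy0)
    filter_upwards [hpath.eventually hnhds, hwedge, continuousAt_fst.eventually_lt_const hs]
      with p hneg hwedge hps hpπ
    exact hneg ⟨by simpa using hps, by simpa using hwedge, by simpa using hpπ⟩
  obtain ⟨s', hs', hball⟩ := Metric.eventually_nhds_iff.1
    (hK.eventually_forall_of_forall_eventually
      (P := fun (x : ℝ) (y : ℝ) => |y| ≤ Real.pi → (q (x + y * Complex.I)).re < 0) hlocal)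
  refine ⟨s', hs', fun ζ hre hres hr hπ => ?_⟩
  have hlt := hball (by rwa [dist_zero_right, Real.norm_of_nonneg hre]) ζ.im ⟨hr, hπ⟩ hπ
  rw [Complex.re_add_im] at hlt
  exact hlt.le

lemma exists_logSector_forall_re_le (hlam : 0 < lam) (hs : 0 < s)
    (hq : DifferentiableOn ℂ q (logSector lam s)) (hsmall : q =o[𝓝[logSector lam s] 0] id)
    (hneg : ∀ y : ℝ, y ≠ 0 → |y| ≤ Real.pi → (q (y * Complex.I)).re < 0) (hε : 0 < ε) :
    ∃ lam' s' : ℝ, 0 < lam' ∧ lam' ≤ lam ∧ 0 < s' ∧ s' ≤ s ∧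
      ∀ ζ ∈ logSector lam' s', 0 ≤ ζ.re → (q ζ).re ≤ ε * ζ.re := by
  obtain ⟨r, hr, hnear⟩ := exists_forall_re_le_of_isLittleO hlam hs hq hsmall
    (fun y hy hyπ => (hneg y hy hyπ).le) hε
  obtain ⟨s', hs', hfar⟩ := exists_forall_re_le_of_le_abs_im hlam hs hq.continuousOn hneg hr
  refine ⟨lam / (1 + lam), min s' s, by positivity, div_le_self hlam.le (by linarith),
    lt_min hs' hs, min_le_right _ _, fun ζ hζ hre => ?_⟩
  rcases lt_or_ge |ζ.im| r with him | him
  · exact hnear ζ (logSector_subset_logSector le_rfl (min_le_right _ _) hζ) hre him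
  · exact (hfar ζ hre (hζ.1.trans_le (min_le_left _ _)) him hζ.2.2).trans (by positivity)

end GrowthAcrossImaginaryAxis

section LocalExpansion

variable {R δ : ℝ} {D : Set ℂ} {lam s : ℝ}

lemma tendsto_norm_one_sub_div (hR : R ≠ 0) (D : Set ℂ) :
    Tendsto (fun z : ℂ => ‖1 - z / (R : ℂ)‖) (𝓝[D] R) (𝓝[≥] 0) := by
  refine tendsto_nhdsWithin_iff.2 ⟨?_, Eventually.of_forall fun z => norm_nonneg _⟩
  have hcont : Continuous fun z : ℂ => ‖1 - z / (R : ℂ)‖ := by fun_prop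
  simpa [hR] using (hcont.tendsto (R : ℂ)).mono_left nhdsWithin_le_nhds

lemma isBigO_norm_one_sub_div_rpow_of_le (hR : R ≠ 0) (D : Set ℂ) {p q : ℝ} (hq : 0 < q)
    (hpq : p ≤ q) : (fun z : ℂ => ‖1 - z / (R : ℂ)‖ ^ q) =O[𝓝[D] (R : ℂ)]
      fun z : ℂ => ‖1 - z / (R : ℂ)‖ ^ p :=
  (IsBigO.rpow_rpow_nhdsGE_zero_of_le hpq hq.ne').comp_tendsto (tendsto_norm_one_sub_div hR D)

lemma tendsto_mul_exp_nhdsWithin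
    (hD : Set.MapsTo (fun ζ : ℂ => R * Complex.exp ζ) (logSector lam s) D) :
    Tendsto (fun ζ : ℂ => R * Complex.exp ζ) (𝓝[logSector lam s] 0) (𝓝[D] R) := by
  have hcont : Continuous fun ζ : ℂ => R * Complex.exp ζ := by fun_prop
  simpa using hcont.continuousWithinAt.tendsto_nhdsWithin hD (x := 0)

lemma isBigO_one_sub_exp : (fun ζ : ℂ => 1 - Complex.exp ζ) =O[𝓝 0] id := by
  change _ =O[𝓝 0] fun ζ : ℂ => ζ
  simpa using (Complex.hasDerivAt_exp 0).isBigO_sub.neg_left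

lemma isBigO_norm_one_sub_mul_exp_div_rpow (hR : R ≠ 0) {p : ℝ} (hp : 0 ≤ p) :
    (fun ζ : ℂ => ‖1 - R * Complex.exp ζ / R‖ ^ p) =O[𝓝 0] fun ζ : ℂ => ‖ζ‖ ^ p := by
  simp_rw [mul_div_cancel_left₀ _ (Complex.ofReal_ne_zero.2 hR)]
  exact isBigO_one_sub_exp.norm_norm.rpow hp (Eventually.of_forall fun ζ => norm_nonneg ζ)

lemma isBigO_comp_mul_exp (hR : R ≠ 0)
    (hD : Set.MapsTo (fun ζ : ℂ => R * Complex.exp ζ) (logSector lam s) D) {E : ℂ → ℂ} {p : ℝ}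
    (hp : 0 ≤ p) (hE : E =O[𝓝[D] (R : ℂ)] fun z : ℂ => ‖1 - z / (R : ℂ)‖ ^ p) :
    (fun ζ => E (R * Complex.exp ζ)) =O[𝓝[logSector lam s] 0] fun ζ : ℂ => ‖ζ‖ ^ p := by
  exact (hE.comp_tendsto (tendsto_mul_exp_nhdsWithin hD)).trans
    ((isBigO_norm_one_sub_mul_exp_div_rpow hR hp).mono nhdsWithin_le_nhds)

lemma isBigO_exp_sub_one_sub_id (hδ : δ ≤ 1) :
    (fun ζ : ℂ => Complex.exp ζ - 1 - ζ) =O[𝓝 0] fun ζ => ‖ζ‖ ^ (1 + δ) := by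
  refine IsBigO.of_bound 1 ?_
  filter_upwards [Metric.closedBall_mem_nhds (0 : ℂ) one_pos] with ζ hζ
  rw [mem_closedBall_zero_iff] at hζ
  rw [one_mul, Real.norm_of_nonneg (by positivity)]
  refine (Complex.norm_exp_sub_one_sub_id_le hζ).trans ?_
  rw [← Real.rpow_two]
  rcases eq_or_ne ζ 0 with rfl | hne
  · simp [Real.zero_rpow_nonneg]
  · exact Real.rpow_le_rpow_of_exponent_ge (norm_pos_iff.2 hne) hζ (by linarith)

lemma isBigO_phase_sub_linear (hR : R ≠ 0) (hδ0 : 0 < δ) (hδ : δ ≤ 1) {g : ℂ → ℂ} {K₀ K₁ : ℝ}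
    (hD : Set.MapsTo (fun ζ : ℂ => R * Complex.exp ζ) (logSector lam s) D)
    (hg : (fun z : ℂ => g z - ((K₀ : ℂ) - (K₁ : ℂ) * (1 - z / (R : ℂ)))) =O[𝓝[D] (R : ℂ)]
      fun z : ℂ => ‖1 - z / (R : ℂ)‖ ^ (1 + δ)) :
    (fun ζ => g (R * Complex.exp ζ) - K₀ - K₁ * ζ) =O[𝓝[logSector lam s] 0]
      fun ζ : ℂ => ‖ζ‖ ^ (1 + δ) := by
  have hsum := (isBigO_comp_mul_exp hR hD (by linarith) hg).add
    (((isBigO_exp_sub_one_sub_id hδ).mono nhdsWithin_le_nhds).const_mul_left (K₁ : ℂ))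
  refine hsum.congr_left fun ζ => ?_
  rw [mul_div_cancel_left₀ _ (Complex.ofReal_ne_zero.2 hR)]
  ring

lemma isLittleO_norm_rpow_one_add (hδ : 0 < δ) :
    (fun ζ : ℂ => ‖ζ‖ ^ (1 + δ)) =o[𝓝 0] (id : ℂ → ℂ) := by
  have hsmall : (fun ζ : ℂ => ‖ζ‖ ^ δ) =o[𝓝 0] fun _ => (1 : ℝ) := by
    rw [isLittleO_one_iff]
    simpa [Real.zero_rpow hδ.ne'] using
      (continuous_norm.tendsto (0 : ℂ)).rpow_const (Or.inr hδ.le)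
  have hmul := (isBigO_refl (fun ζ : ℂ => ‖ζ‖) (𝓝 0)).mul_isLittleO hsmall
  refine (hmul.congr (fun ζ => ?_) fun ζ => mul_one _).of_norm_right
  rw [Real.rpow_one_add' (norm_nonneg ζ) (by linarith)]

lemma mul_exp_div_cpow {w : ℂ} (hw : w ≠ 0) (x y : ℂ) (v θs β : ℝ) :
    x * Complex.exp (v * y) / w ^ (-((v * θs + β : ℝ) : ℂ)) =
      x / w ^ (-(β : ℂ)) * Complex.exp (v * (y - -(θs : ℂ) * Complex.log w)) := by
  have hpow : w ^ (-((v * θs + β : ℝ) : ℂ)) =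
      w ^ (-(β : ℂ)) * Complex.exp (-(v * θs * Complex.log w)) := by
    rw [Complex.cpow_def_of_ne_zero hw, Complex.cpow_def_of_ne_zero hw, ← Complex.exp_add]
    push_cast
    congr 1
    ring
  rw [hpow, mul_div_mul_comm, ← Complex.exp_sub]
  congr 2
  ring

lemma isBigO_amplitude_div_sub_one {f g : ℂ → ℂ} {θs β v₂ : ℝ} (hR : R ≠ 0) (hδ : 0 < δ)
    (hDR : (R : ℂ) ∉ D)
    (hg : (fun z : ℂ => g z - (-(θs : ℂ) * Complex.log (1 - z / (R : ℂ)))) =O[𝓝[D] (R : ℂ)]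
      fun z : ℂ => ‖1 - z / (R : ℂ)‖ ^ δ)
    (hf : (fun z : ℂ => f z / (1 - z / (R : ℂ)) ^ (-(β : ℂ)) - 1) =O[𝓝[D] (R : ℂ)]
      fun z : ℂ => ‖1 - z / (R : ℂ)‖ ^ δ) :
    (fun p : ℂ × ℝ => f p.1 * Complex.exp (p.2 * g p.1) /
        (1 - p.1 / (R : ℂ)) ^ (-((p.2 * θs + β : ℝ) : ℂ)) - 1)
      =O[𝓝[D] (R : ℂ) ×ˢ 𝓟 (Set.Icc 0 v₂)] fun p => ‖1 - p.1 / (R : ℂ)‖ ^ δ := by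
  set l := 𝓝[D] (R : ℂ) ×ˢ 𝓟 (Set.Icc 0 v₂)
  set e : ℂ × ℝ → ℂ := fun p => p.2 * (g p.1 - (-(θs : ℂ) * Complex.log (1 - p.1 / (R : ℂ))))
  set h : ℂ × ℝ → ℂ := fun p => f p.1 / (1 - p.1 / (R : ℂ)) ^ (-(β : ℂ)) - 1
  have hsmall : Tendsto (fun p : ℂ × ℝ => ‖1 - p.1 / (R : ℂ)‖ ^ δ) l (𝓝 0) := by
    have hnorm := ((tendsto_norm_one_sub_div hR D).mono_right nhdsWithin_le_nhds).comp
      (tendsto_fst (g := 𝓟 (Set.Icc 0 v₂)))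
    simpa [Real.zero_rpow hδ.ne'] using hnorm.rpow_const (Or.inr hδ.le)
  have hv : (fun p : ℂ × ℝ => (p.2 : ℂ)) =O[l] fun _ => (1 : ℝ) := by
    refine IsBigO.of_bound v₂ ?_
    filter_upwards [tendsto_snd.eventually (mem_principal_self (Set.Icc 0 v₂))] with p ⟨hp0, hp⟩
    simpa [abs_of_nonneg hp0] using hp
  have he : e =O[l] fun p => ‖1 - p.1 / (R : ℂ)‖ ^ δ := by
    exact (hv.mul (hg.comp_tendsto tendsto_fst)).congr_right fun p => one_mul _
  have hexp : (fun p => Complex.exp (e p) - 1) =O[l] fun p => ‖1 - p.1 / (R : ℂ)‖ ^ δ := by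
    have hO := (Complex.hasDerivAt_exp 0).isBigO_sub.comp_tendsto (he.trans_tendsto hsmall)
    simp only [Complex.exp_zero, sub_zero] at hO
    exact hO.trans he
  have hh : h =O[l] fun p => ‖1 - p.1 / (R : ℂ)‖ ^ δ := hf.comp_tendsto tendsto_fst
  have hprod : (fun p => h p * Complex.exp (e p)) =O[l] fun p => ‖1 - p.1 / (R : ℂ)‖ ^ δ := by
    have hone : (fun p => Complex.exp (e p)) =O[l] fun _ => (1 : ℝ) :=
      (he.trans_tendsto hsmall).cexp.isBigO_one ℝ
    simpa using hh.mul hone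
  refine (hprod.add hexp).congr' ?_ EventuallyEq.rfl
  filter_upwards [tendsto_fst.eventually self_mem_nhdsWithin] with p hp
  have hne : 1 - p.1 / (R : ℂ) ≠ 0 := by
    rw [sub_ne_zero, ne_comm, Ne, div_eq_one_iff_eq (Complex.ofReal_ne_zero.2 hR)]
    exact fun hpR => hDR (hpR ▸ hp)
  rw [mul_exp_div_cpow hne]
  simp only [e, h]
  ring

lemma norm_one_sub_exp_cpow_le {ζ : ℂ} (hζ : ‖ζ‖ ≤ 1 / 2) {a : ℝ} (ha : 0 ≤ a) :
    ‖(1 - Complex.exp ζ) ^ (-(a : ℂ))‖ ≤ 2 ^ a * ‖ζ‖ ^ (-a) := by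
  rcases eq_or_ne ζ 0 with rfl | hne
  · rcases ha.eq_or_lt with rfl | ha
    · simp
    · simp [ha.ne']
  have hζ0 : 0 < ‖ζ‖ := norm_pos_iff.2 hne
  have hlower : ‖ζ‖ / 2 ≤ ‖1 - Complex.exp ζ‖ := by
    have hquad := Complex.norm_exp_sub_one_sub_id_le (x := ζ) (by linarith)
    have htri := norm_sub_norm_le (-ζ) (1 - Complex.exp ζ)
    rw [norm_neg, show -ζ - (1 - Complex.exp ζ) = Complex.exp ζ - 1 - ζ by ring] at htri
    nlinarith
  rw [← Complex.ofReal_neg, Complex.norm_cpow_real]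
  calc ‖1 - Complex.exp ζ‖ ^ (-a) ≤ (‖ζ‖ / 2) ^ (-a) :=
        Real.rpow_le_rpow_of_nonpos (by positivity) hlower (by linarith)
    _ = 2 ^ a * ‖ζ‖ ^ (-a) := by
        rw [Real.div_rpow hζ0.le two_pos.le, Real.rpow_neg two_pos.le, div_inv_eq_mul, mul_comm]

lemma exists_norm_amplitude_sub_le {f g : ℂ → ℂ} {θs β : ℝ} (v₂ : ℝ) (hR : R ≠ 0) (hδ : 0 < δ)
    (hDR : (R : ℂ) ∉ D)
    (hD : Set.MapsTo (fun ζ : ℂ => R * Complex.exp ζ) (logSector lam s) D)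
    (hg : (fun z : ℂ => g z - (-(θs : ℂ) * Complex.log (1 - z / (R : ℂ)))) =O[𝓝[D] (R : ℂ)]
      fun z : ℂ => ‖1 - z / (R : ℂ)‖ ^ δ)
    (hf : (fun z : ℂ => f z / (1 - z / (R : ℂ)) ^ (-(β : ℂ)) - 1) =O[𝓝[D] (R : ℂ)]
      fun z : ℂ => ‖1 - z / (R : ℂ)‖ ^ δ) :
    ∃ C r : ℝ, 0 < C ∧ 0 < r ∧ ∀ ζ ∈ logSector lam s, ‖ζ‖ < r → ∀ v ∈ Set.Icc 0 v₂,
      ‖f (R * Complex.exp ζ) * Complex.exp (v * g (R * Complex.exp ζ)) -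
          (1 - Complex.exp ζ) ^ (-((v * θs + β : ℝ) : ℂ))‖ ≤
        C * ‖ζ‖ ^ δ * ‖(1 - Complex.exp ζ) ^ (-((v * θs + β : ℝ) : ℂ))‖ := by
  have hR' := Complex.ofReal_ne_zero.2 hR
  have hamplitude := (isBigO_amplitude_div_sub_one hR hδ hDR hg hf (v₂ := v₂)).comp_tendsto
    ((tendsto_mul_exp_nhdsWithin hD).prodMap (tendsto_id (x := 𝓟 (Set.Icc 0 v₂))))
  have hsize : (fun p : ℂ × ℝ => ‖1 - R * Complex.exp p.1 / R‖ ^ δ)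
      =O[𝓝[logSector lam s] 0 ×ˢ 𝓟 (Set.Icc 0 v₂)] fun p => ‖p.1‖ ^ δ := by
    exact ((isBigO_norm_one_sub_mul_exp_div_rpow hR hδ.le).mono nhdsWithin_le_nhds).comp_tendsto
      tendsto_fst
  obtain ⟨C, hC, hbound⟩ := (hamplitude.trans hsize).exists_pos
  obtain ⟨r, hr, hball⟩ := Metric.mem_nhdsWithin_iff.1
    (eventually_prod_principal_iff.1 hbound.bound)
  refine ⟨C, r, hC, hr, fun ζ hζ hζr v hv => ?_⟩
  have hle := hball ⟨mem_ball_zero_iff.2 hζr, hζ⟩ v hv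
  have hne : (1 - Complex.exp ζ) ^ (-((v * θs + β : ℝ) : ℂ)) ≠ 0 := by
    refine fun hzero => hDR ?_
    have hexp := sub_eq_zero.1 (Complex.cpow_eq_zero_iff _ _ |>.1 hzero).1
    simpa [← hexp] using hD hζ
  simp only [Function.comp_apply, Prod.map_apply, id_eq, mul_div_cancel_left₀ _ hR'] at hle
  rw [div_sub_one hne, norm_div, div_le_iff₀ (norm_pos_iff.2 hne),
    Real.norm_of_nonneg (by positivity)] at hle
  exact hle

end LocalExpansion

section Remainder

lemma norm_exp_sub_exp_le {a b : ℂ} {m : ℝ} (ha : a.re ≤ m) (hb : b.re ≤ m) :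
    ‖Complex.exp a - Complex.exp b‖ ≤ Real.exp m * ‖a - b‖ := by
  have hconv : Convex ℝ {ζ : ℂ | ζ.re ≤ m} := convex_halfSpace_re_le m
  refine hconv.norm_image_sub_le_of_norm_hasDerivWithin_le
    (fun ζ _ => (Complex.hasDerivAt_exp ζ).hasDerivWithinAt) (fun ζ hζ => ?_) hb ha
  rw [Complex.norm_exp]
  exact Real.exp_le_exp.2 hζ

lemma norm_mul_exp_sub_mul_exp_le (F W : ℂ) {a b : ℂ} {m : ℝ} (ha : a.re ≤ m) (hb : b.re ≤ m) :
    ‖F * Complex.exp a - W * Complex.exp b‖ ≤ (‖F - W‖ + ‖W‖ * ‖a - b‖) * Real.exp m := by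
  have hsplit : F * Complex.exp a - W * Complex.exp b =
      (F - W) * Complex.exp a + W * (Complex.exp a - Complex.exp b) := by ring
  have hexp : ‖Complex.exp a‖ ≤ Real.exp m := by
    rw [Complex.norm_exp]
    exact Real.exp_le_exp.2 ha
  calc ‖F * Complex.exp a - W * Complex.exp b‖
      ≤ ‖F - W‖ * Real.exp m + ‖W‖ * (Real.exp m * ‖a - b‖) := by
        rw [hsplit]
        refine (norm_add_le _ _).trans ?_
        rw [norm_mul, norm_mul]
        gcongr
        exact norm_exp_sub_exp_le ha hb
    _ = (‖F - W‖ + ‖W‖ * ‖a - b‖) * Real.exp m := by ring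

lemma exists_rpow_le_mul_exp {c B P γ : ℝ} (hc : 0 < c) (hP : 0 < P) (hγ : 0 < γ) :
    ∃ L : ℝ, 0 < L ∧ ∀ x τ p : ℝ, 0 ≤ τ → c ≤ x → x ≤ 1 + B * τ → |p| ≤ P →
      x ^ p ≤ L * Real.exp (γ * τ) := by
  set L : ℝ := max 1 (max c⁻¹ (B * (P / γ)))
  have hL1 : 1 ≤ L := le_max_left _ _
  have hLc : c⁻¹ ≤ L := (le_max_left _ _).trans (le_max_right _ _)
  have hLB : B * (P / γ) ≤ L := (le_max_right _ _).trans (le_max_right _ _)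
  refine ⟨L ^ P, by positivity, fun x τ p hτ hcx hx hp => ?_⟩
  have hx0 : 0 < x := hc.trans_le hcx
  set y : ℝ := L * Real.exp (γ / P * τ)
  have hexp : 1 + γ / P * τ ≤ Real.exp (γ / P * τ) := by
    linarith [Real.add_one_le_exp (γ / P * τ)]
  have hxy : x ≤ y := calc
    x ≤ L + B * (P / γ) * (γ / P * τ) := by
      have hcancel : B * (P / γ) * (γ / P * τ) = B * τ := by field_simp
      linarith
    _ ≤ L + L * (γ / P * τ) := by gcongr
    _ ≤ y := by nlinarith
  have hLy : L ≤ y := le_mul_of_one_le_right (by positivity) (Real.one_le_exp (by positivity))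
  have hinv : x⁻¹ ≤ y := (inv_anti₀ hc hcx).trans (hLc.trans hLy)
  calc x ^ p ≤ y ^ |p| := by
        rcases abs_cases p with ⟨habs, hp0⟩ | ⟨habs, hp0⟩ <;> rw [habs]
        · gcongr
        · rw [← inv_inv x, Real.inv_rpow (by positivity), ← Real.rpow_neg (by positivity)]
          gcongr
          linarith
    _ ≤ y ^ P := Real.rpow_le_rpow_of_exponent_le (hL1.trans hLy) hp
    _ = L ^ P * Real.exp (γ * τ) := by
        rw [Real.mul_rpow (by positivity) (Real.exp_pos _).le, ← Real.exp_mul]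
        congr 2
        field_simp

/-- The difference between `f(z) exp (v G_N(z)) exp (-N v K₀)`, written through the analytic
continuations `gθ` and `gκ`, and the model function that approximates it near `z = R`. -/
noncomputable def remainder (f gθ gκ : ℂ → ℂ) (R K₀ K₁ θs β : ℝ) (N : ℕ) (v : ℝ) (z : ℂ) : ℂ :=
  f z * Complex.exp (v * gθ z) * Complex.exp (N * v * (gκ z - K₀)) -
    model R ⌊N * v * K₁⌋₊ (v * θs + β) z

variable {f gθ gκ : ℂ → ℂ} {R K₀ K₁ θs β δ v v₂ lam s c : ℝ} {D : Set ℂ} {N : ℕ}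

lemma mul_add_le_of_mem_Icc (hv : v ∈ Set.Icc 0 v₂) : v * θs + β ≤ v₂ * |θs| + |β| :=
  calc v * θs + β ≤ v * |θs| + |β| :=
        add_le_add (mul_le_mul_of_nonneg_left (le_abs_self θs) hv.1) (le_abs_self β)
    _ ≤ v₂ * |θs| + |β| := by gcongr; exact hv.2

lemma differentiableOn_remainder (hf : DifferentiableOn ℂ f D) (hgθ : DifferentiableOn ℂ gθ D)
    (hgκ : DifferentiableOn ℂ gκ D) (hslit : ∀ z ∈ D, 1 - z / R ∈ Complex.slitPlane) :
    DifferentiableOn ℂ (remainder f gθ gκ R K₀ K₁ θs β N v) D := by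
  refine ((hf.mul (hgθ.const_mul _).cexp).mul ((hgκ.sub_const _).const_mul _).cexp).sub ?_
  exact DifferentiableOn.mul (by fun_prop) (DifferentiableOn.cpow (by fun_prop) (by fun_prop) hslit)

lemma cauchyIntegrand_remainder (hR : R ≠ 0) (ζ : ℂ) :
    cauchyIntegrand R N (remainder f gθ gκ R K₀ K₁ θs β N v) ζ =
      f (R * Complex.exp ζ) * Complex.exp (v * gθ (R * Complex.exp ζ)) *
          Complex.exp (N * (v * (gκ (R * Complex.exp ζ) - K₀) - ζ)) -
        (1 - Complex.exp ζ) ^ (-((v * θs + β : ℝ) : ℂ)) *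
          Complex.exp ((⌊N * v * K₁⌋₊ - N) * ζ) := by
  have hphase : Complex.exp (N * (v * (gκ (R * Complex.exp ζ) - K₀) - ζ)) =
      Complex.exp (N * v * (gκ (R * Complex.exp ζ) - K₀)) * Complex.exp (-(N * ζ)) := by
    rw [← Complex.exp_add]
    congr 1
    ring
  have hmodel : Complex.exp ((⌊N * v * K₁⌋₊ - N) * ζ) =
      Complex.exp ζ ^ ⌊N * v * K₁⌋₊ * Complex.exp (-(N * ζ)) := by
    rw [← Complex.exp_nat_mul, ← Complex.exp_add]
    congr 1
    ring
  rw [cauchyIntegrand, remainder, model, hphase, hmodel,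
    mul_div_cancel_left₀ _ (Complex.ofReal_ne_zero.2 hR)]
  ring

lemma natFloor_sub_mul_re_le (hK₁ : 0 ≤ K₁) (hc : c ≤ 1 - v₂ * K₁) (hv : v ∈ Set.Icc 0 v₂) (ζ : ℂ) :
    ((⌊N * v * K₁⌋₊ - N) * ζ : ℂ).re ≤ N * max (-(c * ζ.re)) (-ζ.re) := by
  have hfloor : (⌊N * v * K₁⌋₊ : ℝ) ≤ N * (1 - c) :=
    (Nat.floor_le (mul_nonneg (mul_nonneg N.cast_nonneg hv.1) hK₁)).trans <| by
      rw [mul_assoc]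
      have hle := mul_le_mul_of_nonneg_right hv.2 hK₁
      gcongr
      linarith
  have hre : ((⌊N * v * K₁⌋₊ - N) * ζ : ℂ).re = (⌊N * v * K₁⌋₊ - N) * ζ.re := by
    rw [← Complex.ofReal_natCast, ← Complex.ofReal_natCast, ← Complex.ofReal_sub,
      Complex.re_ofReal_mul]
  rw [hre]
  rcases le_total 0 ζ.re with hζ | hζ
  · calc (⌊N * v * K₁⌋₊ - N) * ζ.re ≤ (N * (1 - c) - N) * ζ.re := by gcongr
      _ = N * -(c * ζ.re) := by ring
      _ ≤ N * max (-(c * ζ.re)) (-ζ.re) := by gcongr; exact le_max_left _ _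
  · calc (⌊N * v * K₁⌋₊ - N) * ζ.re ≤ (0 - N) * ζ.re :=
        mul_le_mul_of_nonpos_right (sub_le_sub_right (Nat.cast_nonneg _) _) hζ
      _ = N * -ζ.re := by ring
      _ ≤ N * max (-(c * ζ.re)) (-ζ.re) := by gcongr; exact le_max_right _ _

lemma norm_phase_sub_natFloor_mul_le (hK₁ : 0 ≤ K₁) (hv : v ∈ Set.Icc 0 v₂) {u ζ : ℂ} {C : ℝ}
    (hu : ‖u - K₁ * ζ‖ ≤ C * ‖ζ‖ ^ (1 + δ)) :
    ‖(N * (v * u - ζ) : ℂ) - (⌊N * v * K₁⌋₊ - N) * ζ‖ ≤ N * v₂ * C * ‖ζ‖ ^ (1 + δ) + ‖ζ‖ := by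
  have hfract : ‖((N * v * K₁ - ⌊N * v * K₁⌋₊ : ℝ) : ℂ)‖ ≤ 1 := by
    rw [Complex.norm_real, Real.norm_of_nonneg
      (sub_nonneg.2 (Nat.floor_le (mul_nonneg (mul_nonneg N.cast_nonneg hv.1) hK₁)))]
    linarith [Nat.lt_floor_add_one (N * v * K₁)]
  have hsplit : (N * (v * u - ζ) : ℂ) - (⌊N * v * K₁⌋₊ - N) * ζ =
      N * v * (u - K₁ * ζ) + ((N * v * K₁ - ⌊N * v * K₁⌋₊ : ℝ) : ℂ) * ζ := by
    push_cast
    ring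
  rw [hsplit]
  refine (norm_add_le _ _).trans (add_le_add ?_ ?_)
  · rw [norm_mul, norm_mul, Complex.norm_natCast, Complex.norm_real, Real.norm_of_nonneg hv.1]
    calc N * v * ‖u - K₁ * ζ‖ ≤ N * v₂ * (C * ‖ζ‖ ^ (1 + δ)) := by
          gcongr
          · exact mul_nonneg N.cast_nonneg (hv.1.trans hv.2)
          · exact hv.2
      _ = N * v₂ * C * ‖ζ‖ ^ (1 + δ) := by ring
  · rw [norm_mul]
    exact mul_le_of_le_one_left (norm_nonneg _) hfract

lemma ne_zero_of_mem_logSector {ζ : ℂ} (hζ : ζ ∈ logSector lam s) : ζ ≠ 0 := by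
  rintro rfl
  simpa using hζ.2.1

lemma norm_mul_exp_sub_mul_exp_le_rpow {F W E E' ζ : ℂ} {a m n A C C' : ℝ} (hn : 0 ≤ n)
    (hδ : δ ≤ 1) (hC : 0 ≤ C) (hC' : 0 ≤ C') (hζ0 : ζ ≠ 0) (hζ : ‖ζ‖ ≤ 1)
    (hF : ‖F - W‖ ≤ C * ‖ζ‖ ^ δ * ‖W‖) (hW : ‖W‖ ≤ A * ‖ζ‖ ^ (-a)) (hE : E.re ≤ m)
    (hE' : E'.re ≤ m) (hEE' : ‖E - E'‖ ≤ n * C' * ‖ζ‖ ^ (1 + δ) + ‖ζ‖) :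
    ‖F * Complex.exp E - W * Complex.exp E'‖ ≤
      A * (C + C' + 1) * ‖ζ‖ ^ (δ - a) * (1 + n * ‖ζ‖) * Real.exp m := by
  have hpos : 0 < ‖ζ‖ := norm_pos_iff.2 hζ0
  have hle : ‖ζ‖ ≤ ‖ζ‖ ^ δ := by
    simpa using Real.rpow_le_rpow_of_exponent_ge hpos hζ hδ
  refine (norm_mul_exp_sub_mul_exp_le F W hE hE').trans ?_
  gcongr
  calc ‖F - W‖ + ‖W‖ * ‖E - E'‖
      ≤ C * ‖ζ‖ ^ δ * ‖W‖ + ‖W‖ * (n * C' * ‖ζ‖ ^ (1 + δ) + ‖ζ‖) := by gcongr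
    _ = ‖W‖ * (C * ‖ζ‖ ^ δ + C' * ‖ζ‖ ^ δ * (n * ‖ζ‖) + ‖ζ‖) := by
        rw [Real.rpow_add hpos, Real.rpow_one]
        ring
    _ ≤ ‖W‖ * ((C + C' + 1) * ‖ζ‖ ^ δ * (1 + n * ‖ζ‖)) := by
        gcongr
        have hnonneg : 0 ≤ C' * ‖ζ‖ ^ δ + (C + 1) * ‖ζ‖ ^ δ * (n * ‖ζ‖) := by positivity
        linarith
    _ ≤ A * ‖ζ‖ ^ (-a) * ((C + C' + 1) * ‖ζ‖ ^ δ * (1 + n * ‖ζ‖)) := by gcongr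
    _ = A * (C + C' + 1) * ‖ζ‖ ^ (δ - a) * (1 + n * ‖ζ‖) := by
        rw [sub_eq_add_neg, Real.rpow_add hpos]
        ring

lemma exists_norm_cauchyIntegrand_remainder_le (hR : R ≠ 0) (hδ0 : 0 < δ) (hδ : δ ≤ 1)
    (hK₁ : 0 ≤ K₁) (hv₂ : 0 ≤ v₂) (hc : c ≤ 1 - v₂ * K₁) (hDR : (R : ℂ) ∉ D)
    (hD : Set.MapsTo (fun ζ : ℂ => R * Complex.exp ζ) (logSector lam s) D)
    (hf : (fun z : ℂ => f z / (1 - z / (R : ℂ)) ^ (-(β : ℂ)) - 1) =O[𝓝[D] (R : ℂ)]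
      fun z : ℂ => ‖1 - z / (R : ℂ)‖ ^ δ)
    (hgθ : (fun z : ℂ => gθ z - (-(θs : ℂ) * Complex.log (1 - z / (R : ℂ)))) =O[𝓝[D] (R : ℂ)]
      fun z : ℂ => ‖1 - z / (R : ℂ)‖ ^ δ)
    (hgκ : (fun z : ℂ => gκ z - ((K₀ : ℂ) - (K₁ : ℂ) * (1 - z / (R : ℂ)))) =O[𝓝[D] (R : ℂ)]
      fun z : ℂ => ‖1 - z / (R : ℂ)‖ ^ (1 + δ))
    (hphase : ∀ ζ ∈ logSector lam s, ∀ v ∈ Set.Icc 0 v₂,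
      (v * (gκ (R * Complex.exp ζ) - K₀) - ζ).re ≤ max (-(c * ζ.re)) (-ζ.re)) :
    ∃ C r : ℝ, 0 < C ∧ 0 < r ∧ ∀ ζ ∈ logSector lam s, ‖ζ‖ < r → ∀ N : ℕ, ∀ v ∈ Set.Icc 0 v₂,
      0 ≤ v * θs + β →
        ‖cauchyIntegrand R N (remainder f gθ gκ R K₀ K₁ θs β N v) ζ‖ ≤
          C * ‖ζ‖ ^ (δ - (v * θs + β)) * (1 + N * ‖ζ‖) *
            Real.exp (N * max (-(c * ζ.re)) (-ζ.re)) := by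
  obtain ⟨C, r, hC, hr, hamplitude⟩ := exists_norm_amplitude_sub_le v₂ hR hδ0 hDR hD hgθ hf
  obtain ⟨C', hC', hlinear⟩ := (isBigO_phase_sub_linear hR hδ0 hδ hD hgκ).exists_pos
  obtain ⟨r', hr', hball⟩ := Metric.mem_nhdsWithin_iff.1 hlinear.bound
  set A : ℝ := 2 ^ (v₂ * |θs| + |β|)
  refine ⟨A * (C + v₂ * C' + 1), min r (min r' (1 / 2)), by positivity, by positivity,
    fun ζ hζ hζr N v hv ha => ?_⟩
  obtain ⟨hζr, hζr', hζ2⟩ : ‖ζ‖ < r ∧ ‖ζ‖ < r' ∧ ‖ζ‖ < 1 / 2 := by simpa only [lt_min_iff] using hζr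
  have hW : ‖(1 - Complex.exp ζ) ^ (-((v * θs + β : ℝ) : ℂ))‖ ≤ A * ‖ζ‖ ^ (-(v * θs + β)) := by
    refine (norm_one_sub_exp_cpow_le hζ2.le ha).trans ?_
    exact mul_le_mul_of_nonneg_right (Real.rpow_le_rpow_of_exponent_le one_le_two
      (mul_add_le_of_mem_Icc hv)) (by positivity)
  have hq : ‖gκ (R * Complex.exp ζ) - K₀ - K₁ * ζ‖ ≤ C' * ‖‖ζ‖ ^ (1 + δ)‖ :=
    hball ⟨mem_ball_zero_iff.2 hζr', hζ⟩
  rw [Real.norm_of_nonneg (by positivity : 0 ≤ ‖ζ‖ ^ (1 + δ))] at hq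
  have hre : (N * (v * (gκ (R * Complex.exp ζ) - K₀) - ζ) : ℂ).re ≤
      N * max (-(c * ζ.re)) (-ζ.re) := by
    rw [← Complex.ofReal_natCast, Complex.re_ofReal_mul]
    exact mul_le_mul_of_nonneg_left (hphase ζ hζ v hv) N.cast_nonneg
  have hdiff := norm_phase_sub_natFloor_mul_le (N := N) hK₁ hv hq
  rw [mul_assoc (N : ℝ) v₂ C'] at hdiff
  rw [cauchyIntegrand_remainder hR]
  exact norm_mul_exp_sub_mul_exp_le_rpow N.cast_nonneg hδ hC.le (by positivity)
    (ne_zero_of_mem_logSector hζ) (by linarith) (hamplitude ζ hζ hζr v hv) hW hre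
    (natFloor_sub_mul_re_le hK₁ hc hv ζ) hdiff

end Remainder

section RemainderEstimate

variable {lam s c : ℝ}

lemma lineMap_neg_re (ε : ℝ) (ω : ℂ) (t : ℝ) :
    (AffineMap.lineMap (-ε : ℂ) ω t).re = t * ω.re - (1 - t) * ε := by
  simp [AffineMap.lineMap_apply_module]
  ring

lemma lineMap_neg_im (ε : ℝ) (ω : ℂ) (t : ℝ) :
    (AffineMap.lineMap (-ε : ℂ) ω t).im = t * ω.im := by
  simp [AffineMap.lineMap_apply_module]

lemma norm_lineMap_neg_le {ε t : ℝ} (hε : 0 ≤ ε) (ht : t ∈ Set.Icc 0 1) (ω : ℂ) :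
    ‖AffineMap.lineMap (-ε : ℂ) ω t‖ ≤ (1 - t) * ε + t * ‖ω‖ := by
  rw [AffineMap.lineMap_apply_module]
  refine (norm_add_le _ _).trans_eq ?_
  rw [norm_smul, norm_smul, norm_neg, Complex.norm_real, Real.norm_of_nonneg hε,
    Real.norm_of_nonneg ht.1, Real.norm_of_nonneg (sub_nonneg.2 ht.2)]

lemma lineMap_neg_mem_logSector (hs : 0 < s) {ε t : ℝ} (hε : 0 < ε) {ω : ℂ}
    (hω : ω ∈ logSector lam s) (ht : t ∈ Set.Icc 0 1) :
    AffineMap.lineMap (-ε : ℂ) ω t ∈ logSector lam s := by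
  obtain ⟨hωs, hωlam, hωπ⟩ := hω
  rw [logSector, Set.mem_ofPred_eq, lineMap_neg_re, lineMap_neg_im, abs_mul, abs_of_nonneg ht.1]
  rcases ht.1.eq_or_lt with rfl | ht0
  · simpa [hε, Real.pi_nonneg] using (neg_neg_of_pos hε).trans hs
  have hεt : 0 ≤ (1 - t) * ε := mul_nonneg (sub_nonneg.2 ht.2) hε.le
  refine ⟨?_, ?_, (mul_le_of_le_one_left (abs_nonneg _) ht.2).trans hωπ⟩
  · linarith [mul_lt_mul_of_pos_left hωs ht0, mul_le_of_le_one_left hs.le ht.2]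
  · linarith [mul_lt_mul_of_pos_left hωlam ht0]

lemma le_norm_lineMap_neg_mul {ε t : ℝ} (hε : 0 ≤ ε) {ω : ℂ} (hω : 0 ≤ ω.re) (hωim : ω.im ≠ 0)
    (ht : 0 ≤ t) :
    ε ≤ ‖AffineMap.lineMap (-ε : ℂ) ω t‖ * (1 + (ω.re + ε) / |ω.im|) := by
  set ζ : ℂ := AffineMap.lineMap (-ε : ℂ) ω t
  have him : 0 < |ω.im| := abs_pos.2 hωim
  have hre : ζ.re = t * ω.re - (1 - t) * ε := lineMap_neg_re ε ω t
  have ht' : t ≤ ‖ζ‖ / |ω.im| := by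
    rw [le_div_iff₀ him, ← abs_of_nonneg ht, ← abs_mul, ← lineMap_neg_im ε ω t]
    exact Complex.abs_im_le_norm ζ
  calc ε = -ζ.re + t * (ω.re + ε) := by
        rw [hre]
        ring
    _ ≤ ‖ζ‖ + ‖ζ‖ / |ω.im| * (ω.re + ε) := by
        gcongr
        exact (neg_le_abs _).trans (Complex.abs_re_le_norm ζ)
    _ = ‖ζ‖ * (1 + (ω.re + ε) / |ω.im|) := by ring

lemma mul_max_neg_re_lineMap_le {n t : ℝ} (hn : 0 < n) {ω : ℂ} (hω : 0 ≤ ω.re) (hc0 : 0 ≤ c)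
    (hc : c ≤ 1) (ht : t ∈ Set.Icc 0 1) :
    n * max (-(c * (AffineMap.lineMap (-(n⁻¹ : ℝ) : ℂ) ω t).re))
      (-(AffineMap.lineMap (-(n⁻¹ : ℝ) : ℂ) ω t).re) ≤ 1 - c * ω.re * (n * t) := by
  have hscaled : n * (t * ω.re - (1 - t) * n⁻¹) = ω.re * (n * t) - (1 - t) := by
    field_simp
  have hpos : 0 ≤ ω.re * (n * t) := mul_nonneg hω (mul_nonneg hn.le ht.1)
  rw [lineMap_neg_re, mul_max_of_nonneg _ _ hn.le, mul_neg, mul_neg, mul_left_comm, hscaled]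
  obtain ⟨_, _⟩ := ht
  refine max_le ?_ ?_ <;> nlinarith

lemma mul_norm_lineMap_mem_Icc {n t x y : ℝ} (hn : 1 ≤ n) (hx : 0 < x) (hy : 0 < y)
    (ht : t ∈ Set.Icc 0 1) {ω : ℂ} (hωx : ω.re = x) (hωy : |ω.im| = y) :
    n * ‖AffineMap.lineMap (-(n⁻¹ : ℝ) : ℂ) ω t‖ ∈
      Set.Icc (1 + (x + 1) / y)⁻¹ (1 + (x + y) * (n * t)) := by
  have hn0 : 0 < n := one_pos.trans_le hn
  have ht0 := ht.1
  constructor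
  · rw [inv_le_iff_one_le_mul₀ (by positivity), mul_assoc, ← inv_le_iff_one_le_mul₀' hn0]
    refine (le_norm_lineMap_neg_mul (inv_nonneg.2 hn0.le) (hωx ▸ hx.le)
      (abs_pos.1 (hωy ▸ hy)) ht0).trans ?_
    rw [hωx, hωy]
    gcongr
    exact inv_le_one_of_one_le₀ hn
  · have hω : ‖ω‖ ≤ x + y := by
      simpa [hωx, hωy, abs_of_pos hx] using Complex.norm_le_abs_re_add_abs_im ω
    calc n * ‖AffineMap.lineMap (-(n⁻¹ : ℝ) : ℂ) ω t‖ ≤ n * ((1 - t) * n⁻¹ + t * (x + y)) := by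
          gcongr
          exact (norm_lineMap_neg_le (inv_nonneg.2 hn0.le) ht ω).trans (by gcongr)
      _ = 1 - t + (x + y) * (n * t) := by field_simp
      _ ≤ 1 + (x + y) * (n * t) := by linarith

lemma exists_rpow_mul_exp_lineMap_le (hc0 : 0 < c) (hc : c ≤ 1) {x y P : ℝ} (hx : 0 < x)
    (hy : 0 < y) (hP : 0 ≤ P) :
    ∃ L : ℝ, 0 < L ∧ ∀ n p t : ℝ, 1 ≤ n → |p| ≤ P → t ∈ Set.Icc 0 1 → ∀ ζ ω : ℂ,
      ω.re = x → |ω.im| = y → ζ = AffineMap.lineMap (-(n⁻¹ : ℝ) : ℂ) ω t →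
        ‖ζ‖ ^ p * (1 + n * ‖ζ‖) * Real.exp (n * max (-(c * ζ.re)) (-ζ.re)) ≤
          L * n ^ (-p) * Real.exp (-(c * x / 2 * n * t)) := by
  obtain ⟨L, hL, hrpow⟩ := exists_rpow_le_mul_exp (c := (1 + (x + 1) / y)⁻¹) (B := x + y)
    (P := P + 1) (γ := c * x / 2) (by positivity) (by positivity) (by positivity)
  refine ⟨2 * L * Real.exp 1, by positivity, fun n p t hn hp ht ζ ω hωx hωy hζ => ?_⟩
  have hn0 : 0 < n := one_pos.trans_le hn
  obtain ⟨hlower, hupper⟩ := hζ ▸ mul_norm_lineMap_mem_Icc hn hx hy ht hωx hωy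
  have hζ0 : 0 < ‖ζ‖ := pos_of_mul_pos_right ((inv_pos.2 (by positivity)).trans_le hlower) hn0.le
  have hexp : n * max (-(c * ζ.re)) (-ζ.re) ≤ 1 - c * x * (n * t) := by
    rw [hζ, ← hωx]
    exact mul_max_neg_re_lineMap_le hn0 (hωx ▸ hx.le) hc0.le hc ht
  obtain ⟨hp1, hp2⟩ := abs_le.1 hp
  have hrpow₁ := hrpow _ (n * t) p (mul_nonneg hn0.le ht.1) hlower hupper (by linarith)
  have hrpow₂ := hrpow _ (n * t) (p + 1) (mul_nonneg hn0.le ht.1) hlower hupper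
    (abs_le.2 ⟨by linarith, by linarith⟩)
  calc ‖ζ‖ ^ p * (1 + n * ‖ζ‖) * Real.exp (n * max (-(c * ζ.re)) (-ζ.re))
      = n ^ (-p) * ((n * ‖ζ‖) ^ p + (n * ‖ζ‖) ^ (p + 1)) *
          Real.exp (n * max (-(c * ζ.re)) (-ζ.re)) := by
        rw [Real.rpow_add_one (by positivity), Real.mul_rpow hn0.le hζ0.le, Real.rpow_neg hn0.le]
        field_simp
    _ ≤ n ^ (-p) * (L * Real.exp (c * x / 2 * (n * t)) + L * Real.exp (c * x / 2 * (n * t))) *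
          Real.exp (1 - c * x * (n * t)) := by gcongr
    _ = 2 * L * Real.exp 1 * n ^ (-p) * Real.exp (-(c * x / 2 * n * t)) := by
        rw [show 1 - c * x * (n * t) = 1 + (-(c * x / 2 * n * t) - c * x / 2 * (n * t)) by ring,
          Real.exp_add, Real.exp_sub]
        field_simp
        ring

lemma exists_apex (hlam : 0 < lam) (hs : 0 < s) {r : ℝ} (hr : 0 < r) :
    ∃ ω ∈ logSector lam s, 0 < ω.re ∧ 0 < ω.im ∧ ‖ω‖ < r ∧ ω ∈ wedgeStrip lam s := by
  have hcont : Continuous fun t : ℝ => t * (lam / 2 + Complex.I) := by fun_prop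
  have hsmall : ∀ᶠ t : ℝ in 𝓝[>] 0,
      ‖t * (lam / 2 + Complex.I)‖ < min r (min s Real.pi) :=
    (hcont.norm.tendsto' 0 0 (by simp)).mono_left nhdsWithin_le_nhds |>.eventually_lt_const
      (by positivity)
  obtain ⟨t, ht, ht0 : 0 < t⟩ := (hsmall.and self_mem_nhdsWithin).exists
  set ω : ℂ := t * (lam / 2 + Complex.I)
  have hre : ω.re = t * (lam / 2) := by simp [ω]
  have him : ω.im = t := by simp [ω]
  obtain ⟨hωr, hωs, hωπ⟩ : ‖ω‖ < r ∧ ‖ω‖ < s ∧ ‖ω‖ < Real.pi := by simpa only [lt_min_iff] using ht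
  have hres : ω.re < s := (Complex.re_le_norm ω).trans_lt hωs
  have htπ : t < Real.pi := him ▸ (le_abs_self _).trans_lt ((Complex.abs_im_le_norm ω).trans_lt hωπ)
  have hwedge : ω.re < lam * ω.im := by
    rw [hre, him]
    nlinarith
  refine ⟨ω, ⟨hres, ?_, ?_⟩, hre ▸ by positivity, him ▸ ht0, hωr, hres, hwedge, ?_⟩
  · rwa [abs_of_pos (him ▸ ht0)]
  · rw [him, abs_of_pos ht0]
    exact htπ.le
  · refine hwedge.trans ?_
    rw [him]
    gcongr
    linarith

end RemainderEstimate

section Transfer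

variable {R δ lam s c : ℝ} {D : Set ℂ}

lemma exists_exp_neg_mul_le_rpow {γ P : ℝ} (hγ : 0 < γ) (hP : 0 < P) :
    ∃ L : ℝ, 0 < L ∧ ∀ n p : ℝ, 1 ≤ n → -P ≤ p → Real.exp (-(γ * n)) ≤ L * n ^ p := by
  obtain ⟨L, hL, hrpow⟩ := exists_rpow_le_mul_exp (c := 1) (B := 1) one_pos hP hγ
  refine ⟨L, hL, fun n p hn hp => ?_⟩
  have hle := hrpow n n P (by linarith) hn (by linarith) (abs_of_pos hP).le
  calc Real.exp (-(γ * n)) ≤ L * n ^ (-P) := by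
        rw [Real.rpow_neg (by linarith), Real.exp_neg, ← div_eq_mul_inv,
          le_div_iff₀ (by positivity), inv_mul_le_iff₀ (Real.exp_pos _), mul_comm]
        exact hle
    _ ≤ L * n ^ p := by gcongr

lemma exists_norm_cauchyIntegrand_lineMap_neg_le (hδ : 0 ≤ δ) (hs : 0 < s) (hc0 : 0 < c)
    (hc : c ≤ 1) {ω : ℂ} (hω : ω ∈ logSector lam s) (hωre : 0 < ω.re) (hωim : 0 < ω.im)
    {A B : ℝ} (hA : 0 ≤ A) (hB : 0 ≤ B) :
    ∃ L : ℝ, 0 < L ∧ ∀ N : ℕ, 1 ≤ N → (N : ℝ)⁻¹ ≤ ‖ω‖ → ∀ H : ℂ → ℂ, ∀ a ∈ Set.Icc 0 A,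
      (∀ ζ ∈ logSector lam s, ‖ζ‖ ≤ ‖ω‖ → ‖cauchyIntegrand R N H ζ‖ ≤
        B * (‖ζ‖ ^ (δ - a) * (1 + N * ‖ζ‖) * Real.exp (N * max (-(c * ζ.re)) (-ζ.re)))) →
      ∀ ω' : ℂ, ω' = ω ∨ ω' = (starRingEnd ℂ) ω → ∀ t ∈ Set.Icc (0 : ℝ) 1,
        ‖cauchyIntegrand R N H (AffineMap.lineMap (-((N : ℝ)⁻¹ : ℝ) : ℂ) ω' t)‖ ≤
          B * (L * N ^ (-(δ - a))) * Real.exp (-(c * ω.re / 2 * N * t)) := by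
  obtain ⟨L, hL, hpath⟩ := exists_rpow_mul_exp_lineMap_le hc0 hc hωre hωim (add_nonneg hδ hA)
  refine ⟨L, hL, fun N hN1 hNω H a ha hlocal ω' hω' t ht => ?_⟩
  have hN : (1 : ℝ) ≤ N := Nat.one_le_cast.2 hN1
  have hε : 0 < (N : ℝ)⁻¹ := inv_pos.2 (one_pos.trans_le hN)
  obtain ⟨hre, him, hnorm⟩ : ω'.re = ω.re ∧ |ω'.im| = ω.im ∧ ‖ω'‖ = ‖ω‖ := by
    rcases hω' with rfl | rfl <;> simp [abs_of_pos hωim]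
  have hmem : ω' ∈ logSector lam s := by
    simpa only [logSector, Set.mem_ofPred_eq, hre, him, abs_of_pos hωim] using hω
  refine (hlocal _ (lineMap_neg_mem_logSector hs hε hmem ht) ?_).trans ?_
  · refine (norm_lineMap_neg_le hε.le ht ω').trans ?_
    rw [hnorm]
    nlinarith [ht.2]
  · rw [mul_assoc B]
    exact mul_le_mul_of_nonneg_left (hpath N (δ - a) t hN
      (abs_le.2 ⟨by linarith [ha.2], by linarith [ha.1]⟩) ht _ ω' hre him rfl) hB

lemma exists_norm_coeffAt_mul_pow_le (hR : 0 < R) (hδ : 0 < δ) (hlam : 0 < lam) (hs : 0 < s)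
    (hc0 : 0 < c) (hc : c ≤ 1) (hball : Metric.ball 0 R ⊆ D)
    (hD : Set.MapsTo (fun ζ : ℂ => R * Complex.exp ζ) (logSector lam s) D) {ω : ℂ}
    (hω : ω ∈ logSector lam s) (hωw : ω ∈ wedgeStrip lam s) (hωre : 0 < ω.re) (hωim : 0 < ω.im)
    {A B : ℝ} (hA : 0 ≤ A) (hB : 0 ≤ B) :
    ∃ C : ℝ, ∀ᶠ N : ℕ in atTop, ∀ H : ℂ → ℂ, DifferentiableOn ℂ H D → ∀ a ∈ Set.Icc 0 A,
      (∀ ζ ∈ logSector lam s, ‖ζ‖ ≤ ‖ω‖ → ‖cauchyIntegrand R N H ζ‖ ≤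
        B * (‖ζ‖ ^ (δ - a) * (1 + N * ‖ζ‖) * Real.exp (N * max (-(c * ζ.re)) (-ζ.re)))) →
      (∀ ζ : ℂ, ζ.re = ω.re → ω.im ≤ |ζ.im| → |ζ.im| ≤ Real.pi →
        ‖cauchyIntegrand R N H ζ‖ ≤ B * Real.exp (-(c * ω.re * N))) →
      ‖coeffAt N H‖ * R ^ N ≤ C * (N : ℝ) ^ (a - 1 - δ) := by
  obtain ⟨L, hL, hslanted⟩ := exists_norm_cauchyIntegrand_lineMap_neg_le (R := R) hδ.le hs hc0 hc hω
    hωre hωim hA hB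
  obtain ⟨L', hL', htail⟩ := exists_exp_neg_mul_le_rpow (mul_pos hc0 hωre) (P := 1 + δ)
    (by positivity)
  have hω0 : 0 < ‖ω‖ := hωre.trans_le (Complex.re_le_norm ω)
  refine ⟨(‖ω‖ + 1) * (B * L / (c * ω.re / 2)) + B * L', ?_⟩
  filter_upwards [tendsto_inv_atTop_nhds_zero_nat.eventually_le_const hω0, eventually_ge_atTop 1]
    with N hNω hN1 H hH a ha hlocal hvertical
  have hN : (1 : ℝ) ≤ N := Nat.one_le_cast.2 hN1
  have hN0 : (0 : ℝ) < N := one_pos.trans_le hN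
  have hε : 0 < (N : ℝ)⁻¹ := inv_pos.2 hN0
  calc ‖coeffAt N H‖ * R ^ N
      ≤ ‖ω + ((N : ℝ)⁻¹ : ℝ)‖ * (B * (L * N ^ (-(δ - a))) / (c * ω.re / 2 * N)) +
          B * Real.exp (-(c * ω.re * N)) :=
        norm_coeffAt_mul_pow_le hR hlam hs hball hD hH hωw hωim.le
          ((le_abs_self _).trans hω.2.2) hε (by positivity)
          (hslanted N hN1 hNω H a ha hlocal) hvertical
    _ ≤ (‖ω‖ + 1) * (B * (L * N ^ (-(δ - a))) / (c * ω.re / 2 * N)) +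
          B * (L' * N ^ (a - 1 - δ)) := by
        gcongr
        · refine (norm_add_le _ _).trans ?_
          rw [Complex.norm_real, Real.norm_of_nonneg hε.le]
          gcongr
          exact inv_le_one_of_one_le₀ hN
        · exact htail N _ hN (by linarith [ha.1])
    _ = ((‖ω‖ + 1) * (B * L / (c * ω.re / 2)) + B * L') * N ^ (a - 1 - δ) := by
        rw [show a - 1 - δ = -(δ - a) - 1 by ring, Real.rpow_sub_one hN0.ne']
        field_simp

end Transfer

section CoefficientBound

variable {f gθ gκ : ℂ → ℂ} {R K₀ K₁ θs β δ v₂ lam s c : ℝ} {D : Set ℂ}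

lemma isCompact_re_eq_abs_im_mem_Icc (x a b : ℝ) :
    IsCompact {ζ : ℂ | ζ.re = x ∧ |ζ.im| ∈ Set.Icc a b} := by
  refine Metric.isCompact_of_isClosed_isBounded ?_ ?_
  · exact (isClosed_eq Complex.continuous_re continuous_const).inter
      (isClosed_Icc.preimage Complex.continuous_im.abs)
  · refine (Metric.isBounded_closedBall (x := (0 : ℂ)) (r := |x| + b)).subset
      fun ζ hζ => mem_closedBall_zero_iff.2 ((Complex.norm_le_abs_re_add_abs_im ζ).trans ?_)
    rw [hζ.1]
    exact add_le_add le_rfl hζ.2.2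

lemma continuousOn_norm_amplitude_add (hR : R ≠ 0)
    (hslit : ∀ z ∈ D, 1 - z / R ∈ Complex.slitPlane) (hf : ContinuousOn f D)
    (hgθ : ContinuousOn gθ D) (θs β : ℝ) :
    ContinuousOn (fun p : ℂ × ℝ =>
      ‖f (R * Complex.exp p.1) * Complex.exp (p.2 * gθ (R * Complex.exp p.1))‖ +
        ‖(1 - Complex.exp p.1) ^ (-((p.2 * θs + β : ℝ) : ℂ))‖)
      {p | R * Complex.exp p.1 ∈ D} := by
  have hmaps : Set.MapsTo (fun p : ℂ × ℝ => (R : ℂ) * Complex.exp p.1)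
    {p | R * Complex.exp p.1 ∈ D} D := fun p hp => hp
  have hexp : ContinuousOn (fun p : ℂ × ℝ => (R : ℂ) * Complex.exp p.1)
      {p | R * Complex.exp p.1 ∈ D} := by fun_prop
  have hv : Continuous fun p : ℂ × ℝ => (p.2 : ℂ) := by fun_prop
  refine ((hf.comp hexp hmaps).mul (hv.continuousOn.mul (hgθ.comp hexp hmaps)).cexp).norm.add
    (ContinuousOn.cpow (by fun_prop) (by fun_prop) fun p hp => ?_).norm
  simpa only [mul_div_cancel_left₀ _ (Complex.ofReal_ne_zero.2 hR)] using hslit _ hp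

lemma exists_norm_amplitude_add_le_of_re_eq (hR : R ≠ 0)
    (hslit : ∀ z ∈ D, 1 - z / R ∈ Complex.slitPlane) (hf : ContinuousOn f D)
    (hgθ : ContinuousOn gθ D) (θs β v₂ : ℝ) {x a b : ℝ}
    (hD : ∀ ζ : ℂ, ζ.re = x → |ζ.im| ∈ Set.Icc a b → R * Complex.exp ζ ∈ D) :
    ∃ B : ℝ, ∀ ζ : ℂ, ζ.re = x → |ζ.im| ∈ Set.Icc a b → ∀ v ∈ Set.Icc 0 v₂,
      ‖f (R * Complex.exp ζ) * Complex.exp (v * gθ (R * Complex.exp ζ))‖ +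
        ‖(1 - Complex.exp ζ) ^ (-((v * θs + β : ℝ) : ℂ))‖ ≤ B := by
  obtain ⟨B, hB⟩ := ((isCompact_re_eq_abs_im_mem_Icc x a b).prod
    (isCompact_Icc (a := (0 : ℝ)) (b := v₂))).bddAbove_image
    ((continuousOn_norm_amplitude_add hR hslit hf hgθ θs β).mono fun p hp => hD _ hp.1.1 hp.1.2)
  exact ⟨B, fun ζ hre him v hv => hB ⟨(ζ, v), ⟨⟨hre, him⟩, hv⟩, rfl⟩⟩

lemma exists_norm_cauchyIntegrand_remainder_le_of_re_eq (hR : R ≠ 0) (hlam : 0 ≤ lam)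
    (hK₁ : 0 ≤ K₁) (hc1 : c ≤ 1) (hc : c ≤ 1 - v₂ * K₁)
    (hD : Set.MapsTo (fun ζ : ℂ => R * Complex.exp ζ) (logSector lam s) D)
    (hslit : ∀ z ∈ D, 1 - z / R ∈ Complex.slitPlane) (hf : ContinuousOn f D)
    (hgθ : ContinuousOn gθ D)
    (hphase : ∀ ζ ∈ logSector lam s, ∀ v ∈ Set.Icc 0 v₂,
      (v * (gκ (R * Complex.exp ζ) - K₀) - ζ).re ≤ max (-(c * ζ.re)) (-ζ.re))
    {ω : ℂ} (hω : ω ∈ logSector lam s) (hωre : 0 ≤ ω.re) :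
    ∃ B : ℝ, ∀ (N : ℕ), ∀ v ∈ Set.Icc 0 v₂, ∀ ζ : ℂ, ζ.re = ω.re →
      |ζ.im| ∈ Set.Icc |ω.im| Real.pi →
        ‖cauchyIntegrand R N (remainder f gθ gκ R K₀ K₁ θs β N v) ζ‖ ≤
          B * Real.exp (-(c * ω.re * N)) := by
  have hmem : ∀ ζ : ℂ, ζ.re = ω.re → |ζ.im| ∈ Set.Icc |ω.im| Real.pi → ζ ∈ logSector lam s :=
    fun ζ hre him => ⟨hre.trans_lt hω.1,
      hre.trans_lt (hω.2.1.trans_le (mul_le_mul_of_nonneg_left him.1 hlam)), him.2⟩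
  obtain ⟨B, hamplitude⟩ := exists_norm_amplitude_add_le_of_re_eq hR hslit hf hgθ θs β v₂
    fun ζ hre him => hD (hmem ζ hre him)
  refine ⟨B, fun N v hv ζ hre him => ?_⟩
  have hζ := hmem ζ hre him
  have hmax : N * max (-(c * ζ.re)) (-ζ.re) = -(c * ω.re * N) := by
    rw [max_eq_left (neg_le_neg (by rw [hre]; exact mul_le_of_le_one_left hωre hc1)), hre]
    ring
  have hexp : (N * (v * (gκ (R * Complex.exp ζ) - K₀) - ζ) : ℂ).re ≤ -(c * ω.re * N) := by
    rw [← hmax, ← Complex.ofReal_natCast, Complex.re_ofReal_mul]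
    exact mul_le_mul_of_nonneg_left (hphase ζ hζ v hv) N.cast_nonneg
  have hexp' := (natFloor_sub_mul_re_le (N := N) hK₁ hc hv ζ).trans_eq hmax
  rw [cauchyIntegrand_remainder hR]
  refine (norm_sub_le _ _).trans ?_
  rw [norm_mul, norm_mul _ (Complex.exp ((⌊N * v * K₁⌋₊ - N) * ζ)), Complex.norm_exp,
    Complex.norm_exp]
  calc _ ≤ ‖f (R * Complex.exp ζ) * Complex.exp (v * gθ (R * Complex.exp ζ))‖ *
          Real.exp (-(c * ω.re * N)) + ‖(1 - Complex.exp ζ) ^ (-((v * θs + β : ℝ) : ℂ))‖ *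
          Real.exp (-(c * ω.re * N)) := by gcongr
    _ ≤ B * Real.exp (-(c * ω.re * N)) := by
        rw [← add_mul]
        exact mul_le_mul_of_nonneg_right (hamplitude ζ hre him v hv) (Real.exp_pos _).le

lemma exists_norm_coeffAt_remainder_le (hR : 0 < R) (hδ0 : 0 < δ) (hδ : δ ≤ 1) (hlam : 0 < lam)
    (hs : 0 < s) (hK₁ : 0 ≤ K₁) (hv₂ : 0 ≤ v₂) (hc0 : 0 < c) (hc : c ≤ 1 - v₂ * K₁)
    (hball : Metric.ball 0 R ⊆ D) (hslit : ∀ z ∈ D, 1 - z / R ∈ Complex.slitPlane)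
    (hD : Set.MapsTo (fun ζ : ℂ => R * Complex.exp ζ) (logSector lam s) D)
    (hf : DifferentiableOn ℂ f D) (hgθ : DifferentiableOn ℂ gθ D) (hgκ : DifferentiableOn ℂ gκ D)
    (hf_exp : (fun z : ℂ => f z / (1 - z / (R : ℂ)) ^ (-(β : ℂ)) - 1) =O[𝓝[D] (R : ℂ)]
      fun z : ℂ => ‖1 - z / (R : ℂ)‖ ^ δ)
    (hgθ_exp : (fun z : ℂ => gθ z - (-(θs : ℂ) * Complex.log (1 - z / (R : ℂ))))
      =O[𝓝[D] (R : ℂ)] fun z : ℂ => ‖1 - z / (R : ℂ)‖ ^ δ)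
    (hgκ_exp : (fun z : ℂ => gκ z - ((K₀ : ℂ) - (K₁ : ℂ) * (1 - z / (R : ℂ))))
      =O[𝓝[D] (R : ℂ)] fun z : ℂ => ‖1 - z / (R : ℂ)‖ ^ (1 + δ))
    (hphase : ∀ ζ ∈ logSector lam s, ∀ v ∈ Set.Icc 0 v₂,
      (v * (gκ (R * Complex.exp ζ) - K₀) - ζ).re ≤ max (-(c * ζ.re)) (-ζ.re)) :
    ∃ C : ℝ, ∀ᶠ N : ℕ in atTop, ∀ v ∈ Set.Icc 0 v₂, 0 ≤ v * θs + β →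
      ‖coeffAt N (remainder f gθ gκ R K₀ K₁ θs β N v)‖ * R ^ N ≤
        C * (N : ℝ) ^ (v * θs + β - 1 - δ) := by
  have hc1 : c ≤ 1 := hc.trans (sub_le_self _ (mul_nonneg hv₂ hK₁))
  have hDR : (R : ℂ) ∉ D := fun h => by
    simpa [div_self (Complex.ofReal_ne_zero.2 hR.ne')] using hslit R h
  obtain ⟨C, r, hC, hr, hlocal⟩ := exists_norm_cauchyIntegrand_remainder_le hR.ne' hδ0 hδ hK₁ hv₂
    hc hDR hD hf_exp hgθ_exp hgκ_exp hphase
  obtain ⟨ω, hω, hωre, hωim, hωr, hωw⟩ := exists_apex hlam hs hr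
  obtain ⟨B, hvertical⟩ := exists_norm_cauchyIntegrand_remainder_le_of_re_eq (θs := θs) (β := β)
    hR.ne' hlam.le hK₁ hc1 hc hD hslit hf.continuousOn hgθ.continuousOn hphase hω hωre.le
  obtain ⟨C', hcoeff⟩ := exists_norm_coeffAt_mul_pow_le hR hδ0 hlam hs hc0 hc1 hball hD hω hωw hωre
    hωim (A := v₂ * |θs| + |β|) (B := max C B) (by positivity) (hC.le.trans (le_max_left _ _))
  refine ⟨C', hcoeff.mono fun N hN v hv ha => hN _ (differentiableOn_remainder hf hgθ hgκ hslit) _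
    ⟨ha, mul_add_le_of_mem_Icc hv⟩ (fun ζ hζ hζω => ?_) fun ζ hre hle hpi => ?_⟩
  · refine (hlocal ζ hζ (hζω.trans_lt hωr) N v hv ha).trans ?_
    rw [mul_assoc, mul_assoc, ← mul_assoc (‖ζ‖ ^ (δ - (v * θs + β)))]
    exact mul_le_mul_of_nonneg_right (le_max_left _ _) (by positivity)
  · exact (hvertical N v hv ζ hre ⟨(abs_of_pos hωim).trans_le hle, hpi⟩).trans
      (mul_le_mul_of_nonneg_right (le_max_right _ _) (Real.exp_pos _).le)

end CoefficientBound

section Growth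

variable {κ : ℕ → ℝ} {R η φ K₀ K₁ δ : ℝ} {g : ℂ → ℂ}

lemma one_sub_div_mem_slitPlane (hR : 0 < R) (hφ : 0 ≤ φ) {z : ℂ} (hz : z ∈ Delta0 R η φ) :
    1 - z / R ∈ Complex.slitPlane := by
  have hR0 : (R : ℂ) ≠ 0 := Complex.ofReal_ne_zero.2 hR.ne'
  by_contra h
  rw [Complex.mem_slitPlane_iff, not_or, not_lt, not_not] at h
  have hreal : z - R = ((-(R * (1 - z / R).re) : ℝ) : ℂ) := by
    rw [Complex.ofReal_neg, Complex.ofReal_mul, Complex.conj_eq_iff_re.1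
      (Complex.conj_eq_iff_im.2 h.2), mul_sub, mul_one, mul_div_cancel₀ _ hR0, neg_sub]
  have harg := hz.2.2
  rw [hreal, Complex.arg_ofReal_of_nonneg (neg_nonneg.2 (mul_nonpos_of_nonneg_of_nonpos hR.le h.1)),
    abs_zero] at harg
  exact hφ.not_gt harg

lemma exists_logSector_re_continuation_sub_le (hκ : ∀ j : ℕ, 1 ≤ j → 0 ≤ κ j)
    (hNA : NonArithmetic κ) (hND : NonDegenerate κ) (hR : 0 < R) (hη : 0 < η) (hφ : 0 < φ)
    (hφ' : φ < Real.pi / 2) (hRκ : ENNReal.ofReal R ≤ genRadius κ)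
    (hg : IsContinuation κ R η φ g)
    (hK₀ : Tendsto (fun r : ℝ => genFun κ (r : ℂ)) (𝓝[<] R) (𝓝 (K₀ : ℂ))) (hδ0 : 0 < δ)
    (hδ : δ ≤ 1)
    (hg_exp : (fun z : ℂ => g z - ((K₀ : ℂ) - (K₁ : ℂ) * (1 - z / (R : ℂ))))
      =O[𝓝[Delta0 R η φ] (R : ℂ)] fun z : ℂ => ‖1 - z / (R : ℂ)‖ ^ (1 + δ))
    {ε : ℝ} (hε : 0 < ε) :
    ∃ lam s : ℝ, 0 < lam ∧ 0 < s ∧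
      Set.MapsTo (fun ζ : ℂ => R * Complex.exp ζ) (logSector lam s) (Delta0 R η φ) ∧
      ∀ ζ ∈ logSector lam s, 0 ≤ ζ.re →
        (g (R * Complex.exp ζ)).re - K₀ ≤ (K₁ + ε) * ζ.re := by
  obtain ⟨lam, s, hlam, hs, hmaps⟩ := exists_logSector_mapsTo_Delta0 hR hη hφ hφ'
  have hq : DifferentiableOn ℂ (fun ζ => g (R * Complex.exp ζ) - K₀ - K₁ * ζ)
      (logSector lam s) :=
    ((hg.1.comp (by fun_prop) hmaps).sub_const _).sub (by fun_prop)
  have hre (ζ : ℂ) : (g (R * Complex.exp ζ) - K₀ - K₁ * ζ).re =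
      (g (R * Complex.exp ζ)).re - K₀ - K₁ * ζ.re := by
    simp only [Complex.sub_re, Complex.ofReal_re, Complex.re_ofReal_mul]
  have hneg : ∀ y : ℝ, y ≠ 0 → |y| ≤ Real.pi →
      (g (R * Complex.exp (y * Complex.I)) - K₀ - K₁ * (y * Complex.I)).re < 0 := by
    intro y hy hypi
    have hmem : (y * Complex.I : ℂ) ∈ logSector lam s := by
      simpa [logSector, hs, hypi] using mul_pos hlam (abs_pos.2 hy)
    have hlt := re_continuation_lt hκ hNA hND hR hRκ (ball_subset_Delta0 hR hη hφ hφ') hg hK₀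
      (z := R * Complex.exp (y * Complex.I)) (by simp only [norm_mul_exp hR, Complex.re_ofReal_mul,
        Complex.I_re, mul_zero, Real.exp_zero, mul_one]) (hmaps hmem)
    rw [hre, Complex.re_ofReal_mul, Complex.I_re]
    linarith
  obtain ⟨lam', s', hlam', hle, hs', hle', hgrowth⟩ := exists_logSector_forall_re_le hlam hs hq
    ((isBigO_phase_sub_linear hR.ne' hδ0 hδ hmaps hg_exp).trans_isLittleO
      ((isLittleO_norm_rpow_one_add hδ0).mono nhdsWithin_le_nhds)) hneg hε
  refine ⟨lam', s', hlam', hs', hmaps.mono_left (logSector_subset_logSector hle hle'),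
    fun ζ hζ hζ0 => ?_⟩
  have hle := hgrowth ζ hζ hζ0
  rw [hre] at hle
  linarith

lemma exists_logSector_re_phase_le (hκ : ∀ j : ℕ, 1 ≤ j → 0 ≤ κ j) (hNA : NonArithmetic κ)
    (hND : NonDegenerate κ) (hR : 0 < R) (hη : 0 < η) (hφ : 0 < φ)
    (hφ' : φ < Real.pi / 2) (hRκ : ENNReal.ofReal R ≤ genRadius κ)
    (hg : IsContinuation κ R η φ g)
    (hK₀ : Tendsto (fun r : ℝ => genFun κ (r : ℂ)) (𝓝[<] R) (𝓝 (K₀ : ℂ))) (hδ0 : 0 < δ)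
    (hδ : δ ≤ 1)
    (hg_exp : (fun z : ℂ => g z - ((K₀ : ℂ) - (K₁ : ℂ) * (1 - z / (R : ℂ))))
      =O[𝓝[Delta0 R η φ] (R : ℂ)] fun z : ℂ => ‖1 - z / (R : ℂ)‖ ^ (1 + δ))
    (hK₁ : 0 ≤ K₁) {v₂ : ℝ} (hv₂ : 0 ≤ v₂) (hv₂K : v₂ * K₁ < 1) :
    ∃ lam s c : ℝ, 0 < lam ∧ 0 < s ∧ 0 < c ∧ c ≤ 1 - v₂ * K₁ ∧
      Set.MapsTo (fun ζ : ℂ => R * Complex.exp ζ) (logSector lam s) (Delta0 R η φ) ∧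
      ∀ ζ ∈ logSector lam s, ∀ v ∈ Set.Icc 0 v₂,
        (v * (g (R * Complex.exp ζ) - K₀) - ζ).re ≤ max (-(c * ζ.re)) (-ζ.re) := by
  obtain ⟨ε, hε, hεlt⟩ : ∃ ε > 0, v₂ * (K₁ + ε) < 1 := by
    have hcont : Tendsto (fun ε => v₂ * (K₁ + ε)) (𝓝[>] 0) (𝓝 (v₂ * K₁)) :=
      ((by fun_prop : Continuous fun ε => v₂ * (K₁ + ε)).tendsto' _ _ (by rw [add_zero])).mono_left
        nhdsWithin_le_nhds
    exact (eventually_mem_nhdsWithin.and (hcont.eventually_lt_const hv₂K)).exists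
  obtain ⟨lam, s, hlam, hs, hmaps, hgrowth⟩ := exists_logSector_re_continuation_sub_le hκ hNA hND hR
    hη hφ hφ' hRκ hg hK₀ hδ0 hδ hg_exp hε
  refine ⟨lam, s, 1 - v₂ * (K₁ + ε), hlam, hs, sub_pos.2 hεlt,
    sub_le_sub_left (mul_le_mul_of_nonneg_left (le_add_of_nonneg_right hε.le) hv₂) 1, hmaps,
    fun ζ hζ v hv => ?_⟩
  rw [Complex.sub_re, Complex.re_ofReal_mul, Complex.sub_re, Complex.ofReal_re]
  rcases le_or_gt 0 ζ.re with hζ0 | hζ0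
  · refine le_max_of_le_left ?_
    calc v * ((g (R * Complex.exp ζ)).re - K₀) - ζ.re
        ≤ v * ((K₁ + ε) * ζ.re) - ζ.re :=
          sub_le_sub_right (mul_le_mul_of_nonneg_left (hgrowth ζ hζ hζ0) hv.1) _
      _ ≤ v₂ * ((K₁ + ε) * ζ.re) - ζ.re := by gcongr; exact hv.2
      _ = -((1 - v₂ * (K₁ + ε)) * ζ.re) := by ring
  · refine le_max_of_le_right (sub_le_iff_le_add.2 ?_)
    rw [neg_add_cancel]
    exact mul_nonpos_of_nonneg_of_nonpos hv.1 (sub_nonpos.2 (re_continuation_le hκ hRκ hg hK₀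
      (mem_ball_zero_iff.1 (mul_exp_mem_ball hR hζ0))))

end Growth

section Asymptotics

variable {θ κ : ℕ → ℝ} {f gθ gκ : ℂ → ℂ} {R η φ K₀ K₁ θs β δ v v₁ v₂ : ℝ} {N : ℕ}

lemma coeffAt_mul_exp_bigG (hR : 0 < R) (hφ : 0 ≤ φ)
    (hball : Metric.ball 0 R ⊆ Delta0 R η φ) (hf : DifferentiableOn ℂ f (Delta0 R η φ))
    (hgθ : IsContinuation θ R η φ gθ) (hgκ : IsContinuation κ R η φ gκ)
    (hk : ⌊N * v * K₁⌋₊ ≤ N) (ha : 0 < v * θs + β) :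
    coeffAt N (fun z : ℂ => f z * Complex.exp (v * bigG θ κ N z)) =
      (Real.exp (N * v * K₀) : ℝ) * (coeffAt N (remainder f gθ gκ R K₀ K₁ θs β N v) +
        ((Real.Gamma ((N - ⌊N * v * K₁⌋₊ : ℕ) + (v * θs + β)) / (N - ⌊N * v * K₁⌋₊).factorial /
          Real.Gamma (v * θs + β) / R ^ N : ℝ) : ℂ)) := by
  have hmodel := coeffAt_model R ha ⌊N * v * K₁⌋₊ (N - ⌊N * v * K₁⌋₊)
  rw [Nat.sub_add_cancel hk] at hmodel
  have hremainder : AnalyticAt ℂ (remainder f gθ gκ R K₀ K₁ θs β N v) 0 :=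
    ((differentiableOn_remainder hf hgθ.1 hgκ.1 fun z hz =>
      one_sub_div_mem_slitPlane hR hφ hz).mono hball).analyticAt (Metric.ball_mem_nhds 0 hR)
  rw [← hmodel, ← coeffAt_add hremainder (analyticAt_model R _ _), ← coeffAt_const_mul]
  refine coeffAt_congr ?_ N
  filter_upwards [Metric.ball_mem_nhds (0 : ℂ) hR] with z hz
  have hz' : ‖z‖ < R := mem_ball_zero_iff.1 hz
  have hexp : Complex.exp (v * bigG θ κ N z) = (Real.exp (N * v * K₀) : ℝ) *
      (Complex.exp (v * gθ z) * Complex.exp (N * v * (gκ z - K₀))) := by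
    rw [hgθ.2 z hz', hgκ.2 z hz', bigG, Complex.ofReal_exp, ← Complex.exp_add, ← Complex.exp_add]
    congr 1
    push_cast
    ring
  rw [remainder, sub_add_cancel, hexp]
  ring

lemma coeffAt_mul_exp_bigG_div_leadingTerm (hR : 0 < R) (hφ : 0 ≤ φ)
    (hball : Metric.ball 0 R ⊆ Delta0 R η φ) (hf : DifferentiableOn ℂ f (Delta0 R η φ))
    (hgθ : IsContinuation θ R η φ gθ) (hgκ : IsContinuation κ R η φ gκ) (K₀ : ℝ)
    (hN : 0 < N) (hvK : v * K₁ < 1) (ha : 0 < v * θs + β) :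
    coeffAt N (fun z : ℂ => f z * Complex.exp (v * bigG θ κ N z)) /
        (leadingTerm R K₀ K₁ θs β N v : ℂ) =
      coeffAt N (remainder f gθ gκ R K₀ K₁ θs β N v) * ((R ^ N * (Real.Gamma (v * θs + β) /
        (N * (1 - v * K₁)) ^ (v * θs + β - 1)) : ℝ) : ℂ) +
      ((Real.Gamma ((N - ⌊N * v * K₁⌋₊ : ℕ) + (v * θs + β)) / (N - ⌊N * v * K₁⌋₊).factorial /
        (N * (1 - v * K₁)) ^ (v * θs + β - 1) : ℝ) : ℂ) := by
  have hN0 : (0 : ℝ) < N := Nat.cast_pos.2 hN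
  have hk : ⌊N * v * K₁⌋₊ ≤ N := Nat.floor_le_of_le (by nlinarith)
  have hpow : (((N * (1 - v * K₁)) ^ (v * θs + β - 1) : ℝ) : ℂ) ≠ 0 :=
    Complex.ofReal_ne_zero.2 (Real.rpow_pos_of_pos (mul_pos hN0 (sub_pos.2 hvK)) _).ne'
  have hGamma : (Real.Gamma (v * θs + β) : ℂ) ≠ 0 :=
    Complex.ofReal_ne_zero.2 (Real.Gamma_pos_of_pos ha).ne'
  have hexp : (Real.exp (N * v * K₀) : ℂ) ≠ 0 := Complex.ofReal_ne_zero.2 (Real.exp_pos _).ne'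
  have hR' : (R : ℂ) ≠ 0 := Complex.ofReal_ne_zero.2 hR.ne'
  rw [coeffAt_mul_exp_bigG (K₀ := K₀) hR hφ hball hf hgθ hgκ hk ha, leadingTerm]
  simp only [Complex.ofReal_mul, Complex.ofReal_div, Complex.ofReal_pow]
  field_simp

lemma exists_Gamma_div_rpow_le (hvK : ∀ v ∈ Set.Icc v₁ v₂, v * K₁ < 1)
    (ha : ∀ v ∈ Set.Icc v₁ v₂, 0 < v * θs + β) :
    ∃ C : ℝ, ∀ v ∈ Set.Icc v₁ v₂, ∀ x : ℝ, 0 < x →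
      Real.Gamma (v * θs + β) / (x * (1 - v * K₁)) ^ (v * θs + β - 1) ≤
        C * x ^ (1 - (v * θs + β)) := by
  have hcont : ContinuousOn (fun v => Real.Gamma (v * θs + β) / (1 - v * K₁) ^ (v * θs + β - 1))
      (Set.Icc v₁ v₂) := by
    refine ContinuousOn.div (fun v hv => ?_) (ContinuousOn.rpow (by fun_prop) (by fun_prop)
      fun v hv => Or.inl (sub_pos.2 (hvK v hv)).ne')
      fun v hv => (Real.rpow_pos_of_pos (sub_pos.2 (hvK v hv)) _).ne'
    have hGamma := (Real.differentiableAt_Gamma fun m =>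
      ((neg_nonpos.2 m.cast_nonneg).trans_lt (ha v hv)).ne').continuousAt
    exact (ContinuousAt.comp (f := fun v => v * θs + β) hGamma
      (by fun_prop)).continuousWithinAt
  obtain ⟨C, hC⟩ := isCompact_Icc.bddAbove_image hcont
  refine ⟨C, fun v hv x hx => ?_⟩
  have hle := mul_le_mul_of_nonneg_right (hC ⟨v, hv, rfl⟩)
    (Real.rpow_nonneg hx.le (1 - (v * θs + β)))
  refine le_trans (le_of_eq ?_) hle
  rw [Real.mul_rpow hx.le (sub_pos.2 (hvK v hv)).le, div_mul_eq_div_div_swap, div_eq_mul_inv,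
    ← Real.rpow_neg hx.le, neg_sub]

lemma natCast_sub_natFloor_mem_Icc (hv : 0 ≤ v) (hK₁ : 0 ≤ K₁) (hvK : v * K₁ ≤ 1) :
    ((N - ⌊N * v * K₁⌋₊ : ℕ) : ℝ) ∈ Set.Icc (N * (1 - v * K₁)) (N * (1 - v * K₁) + 1) := by
  have hle : N * v * K₁ ≤ N := by
    rw [mul_assoc]
    exact mul_le_of_le_one_right N.cast_nonneg hvK
  rw [Nat.cast_sub (Nat.floor_le_of_le hle), mul_one_sub, ← mul_assoc]
  constructor
  · linarith [Nat.floor_le (mul_nonneg (mul_nonneg N.cast_nonneg hv) hK₁)]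
  · linarith [Nat.lt_floor_add_one (N * v * K₁)]

lemma tendsto_Gamma_natFloor_div_rpow (hv₁ : 0 ≤ v₁) (hK₁ : 0 ≤ K₁) (hv₂K : v₂ * K₁ < 1)
    (ha : ∀ v ∈ Set.Icc v₁ v₂, 0 < v * θs + β) :
    Tendsto (fun p : ℕ × ℝ => Real.Gamma ((p.1 - ⌊p.1 * p.2 * K₁⌋₊ : ℕ) + (p.2 * θs + β)) /
      (p.1 - ⌊p.1 * p.2 * K₁⌋₊).factorial / (p.1 * (1 - p.2 * K₁)) ^ (p.2 * θs + β - 1))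
      (atTop ×ˢ 𝓟 (Set.Icc v₁ v₂)) (𝓝 1) := by
  have hmem : ∀ᶠ p : ℕ × ℝ in atTop ×ˢ 𝓟 (Set.Icc v₁ v₂), p.2 ∈ Set.Icc v₁ v₂ :=
    tendsto_snd.eventually (mem_principal_self _)
  have hbounds : ∀ᶠ p : ℕ × ℝ in atTop ×ˢ 𝓟 (Set.Icc v₁ v₂),
      ((p.1 - ⌊p.1 * p.2 * K₁⌋₊ : ℕ) : ℝ) ∈
        Set.Icc (p.1 * (1 - p.2 * K₁)) (p.1 * (1 - p.2 * K₁) + 1) ∧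
      p.1 * (1 - v₂ * K₁) ≤ p.1 * (1 - p.2 * K₁) := by
    filter_upwards [hmem] with p hp
    have hle : p.2 * K₁ ≤ v₂ * K₁ := mul_le_mul_of_nonneg_right hp.2 hK₁
    exact ⟨natCast_sub_natFloor_mem_Icc (hv₁.trans hp.1) hK₁ (hle.trans hv₂K.le), by gcongr⟩
  have hn : Tendsto (fun p : ℕ × ℝ => p.1 - ⌊p.1 * p.2 * K₁⌋₊) (atTop ×ˢ 𝓟 (Set.Icc v₁ v₂))
      atTop := by
    rw [← tendsto_natCast_atTop_iff (R := ℝ)]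
    refine tendsto_atTop_mono' _ (hbounds.mono fun p hp => hp.2.trans hp.1.1) ?_
    exact (tendsto_natCast_atTop_atTop.comp tendsto_fst).atTop_mul_const (sub_pos.2 hv₂K)
  refine tendsto_Gamma_add_div_factorial (M := v₂ * |θs| + |β|) hn ?_ ?_
  · filter_upwards [hmem] with p hp
    exact ⟨(ha _ hp).le, mul_add_le_of_mem_Icc ⟨hv₁.trans hp.1, hp.2⟩⟩
  · have hinv := (tendsto_const_nhds (x := (1 : ℝ))).sub (tendsto_inv_atTop_nhds_zero_nat.comp hn)
    rw [sub_zero] at hinv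
    refine tendsto_of_tendsto_of_tendsto_of_le_of_le' hinv tendsto_const_nhds ?_ ?_
    · filter_upwards [hbounds, hn.eventually_gt_atTop 0] with p hp hpos
      have hpos' : (0 : ℝ) < (p.1 - ⌊p.1 * p.2 * K₁⌋₊ : ℕ) := Nat.cast_pos.2 hpos
      rw [Function.comp_apply, le_div_iff₀ hpos', sub_mul, one_mul, inv_mul_cancel₀ hpos'.ne']
      linarith [hp.1.2]
    · filter_upwards [hbounds] with p hp
      exact div_le_one_of_le₀ hp.1.1 (Nat.cast_nonneg _)

lemma exists_norm_coeffAt_remainder_le_of_isContinuation (hκ : ∀ j : ℕ, 1 ≤ j → 0 ≤ κ j)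
    (hNA : NonArithmetic κ) (hND : NonDegenerate κ) (hR : 0 < R) (hη : 0 < η) (hφ : 0 < φ)
    (hφ' : φ < Real.pi / 2) (hRκ : ENNReal.ofReal R ≤ genRadius κ)
    (hgκ : IsContinuation κ R η φ gκ)
    (hK₀ : Tendsto (fun r : ℝ => genFun κ (r : ℂ)) (𝓝[<] R) (𝓝 (K₀ : ℂ))) (hδ : 0 < δ)
    (hκ_exp : (fun z : ℂ => gκ z - ((K₀ : ℂ) - (K₁ : ℂ) * (1 - z / (R : ℂ))))
      =O[𝓝[Delta0 R η φ] (R : ℂ)] fun z : ℂ => ‖1 - z / (R : ℂ)‖ ^ (1 + δ))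
    (hgθ : DifferentiableOn ℂ gθ (Delta0 R η φ))
    (hθ_exp : (fun z : ℂ => gθ z - (-(θs : ℂ) * Complex.log (1 - z / (R : ℂ))))
      =O[𝓝[Delta0 R η φ] (R : ℂ)] fun z : ℂ => ‖1 - z / (R : ℂ)‖ ^ δ)
    (hf : DifferentiableOn ℂ f (Delta0 R η φ))
    (hf_exp : (fun z : ℂ => f z / (1 - z / (R : ℂ)) ^ (-(β : ℂ)) - 1)
        =O[𝓝[Delta0 R η φ] (R : ℂ)] fun z : ℂ => ‖1 - z / (R : ℂ)‖ ^ δ)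
    (hK₁ : 0 ≤ K₁) (hv₂ : 0 ≤ v₂) (hv₂K : v₂ * K₁ < 1) :
    ∃ C ε : ℝ, 0 < ε ∧ ∀ᶠ N : ℕ in atTop, ∀ v ∈ Set.Icc 0 v₂, 0 ≤ v * θs + β →
      ‖coeffAt N (remainder f gθ gκ R K₀ K₁ θs β N v)‖ * R ^ N ≤
        C * (N : ℝ) ^ (v * θs + β - 1 - ε) := by
  have hε0 : 0 < min δ 1 := lt_min hδ one_pos
  have hεδ : min δ 1 ≤ δ := min_le_left _ _
  have hweaken := isBigO_norm_one_sub_div_rpow_of_le hR.ne' (Delta0 R η φ) hδ hεδ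
  have hκ_exp' := hκ_exp.trans (isBigO_norm_one_sub_div_rpow_of_le hR.ne' (Delta0 R η φ)
    (add_pos one_pos hδ) (add_le_add_right hεδ 1))
  obtain ⟨lam, s, c, hlam, hs, hc0, hc, hmaps, hphase⟩ := exists_logSector_re_phase_le hκ hNA hND hR
    hη hφ hφ' hRκ hgκ hK₀ hε0 (min_le_right _ _) hκ_exp' hK₁ hv₂ hv₂K
  obtain ⟨C, hC⟩ := exists_norm_coeffAt_remainder_le hR hε0 (min_le_right _ _) hlam hs hK₁ hv₂ hc0
    hc (ball_subset_Delta0 hR hη hφ hφ') (fun z hz => one_sub_div_mem_slitPlane hR hφ.le hz) hmaps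
    hf hgθ hgκ.1 (hf_exp.trans hweaken) (hθ_exp.trans hweaken) hκ_exp' hphase
  exact ⟨C, min δ 1, hε0, hC⟩

lemma tendsto_coeffAt_remainder_mul (hR : 0 < R) {ε C : ℝ} (hε : 0 < ε)
    (hC : ∀ᶠ N : ℕ in atTop, ∀ v ∈ Set.Icc v₁ v₂,
      ‖coeffAt N (remainder f gθ gκ R K₀ K₁ θs β N v)‖ * R ^ N ≤
        C * (N : ℝ) ^ (v * θs + β - 1 - ε))
    (hvK : ∀ v ∈ Set.Icc v₁ v₂, v * K₁ < 1) (ha : ∀ v ∈ Set.Icc v₁ v₂, 0 < v * θs + β) :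
    Tendsto (fun p : ℕ × ℝ => coeffAt p.1 (remainder f gθ gκ R K₀ K₁ θs β p.1 p.2) *
        ((R ^ p.1 * (Real.Gamma (p.2 * θs + β) /
          (p.1 * (1 - p.2 * K₁)) ^ (p.2 * θs + β - 1)) : ℝ) : ℂ))
      (atTop ×ˢ 𝓟 (Set.Icc v₁ v₂)) (𝓝 0) := by
  obtain ⟨C', hC'⟩ := exists_Gamma_div_rpow_le hvK ha
  have hlim : Tendsto (fun p : ℕ × ℝ => C * C' * (p.1 : ℝ) ^ (-ε))
      (atTop ×ˢ 𝓟 (Set.Icc v₁ v₂)) (𝓝 0) := by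
    have hpow := (tendsto_rpow_neg_atTop hε).comp (tendsto_natCast_atTop_atTop.comp
      (tendsto_fst (f := (atTop : Filter ℕ)) (g := 𝓟 (Set.Icc v₁ v₂))))
    simpa only [mul_zero, Function.comp_apply] using hpow.const_mul (C * C')
  refine squeeze_zero_norm' ?_ hlim
  filter_upwards [(hC.and (eventually_gt_atTop 0)).prod_mk (mem_principal_self (Set.Icc v₁ v₂))]
    with ⟨N, v⟩ ⟨⟨hN, hN0⟩, hv⟩
  have hN' : (0 : ℝ) < N := Nat.cast_pos.2 hN0
  have hpos : 0 ≤ Real.Gamma (v * θs + β) / (N * (1 - v * K₁)) ^ (v * θs + β - 1) :=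
    div_nonneg (Real.Gamma_pos_of_pos (ha v hv)).le
      (Real.rpow_nonneg (mul_nonneg hN'.le (sub_pos.2 (hvK v hv)).le) _)
  calc ‖coeffAt N (remainder f gθ gκ R K₀ K₁ θs β N v) * ((R ^ N * (Real.Gamma (v * θs + β) /
        (N * (1 - v * K₁)) ^ (v * θs + β - 1)) : ℝ) : ℂ)‖
      = ‖coeffAt N (remainder f gθ gκ R K₀ K₁ θs β N v)‖ * R ^ N * (Real.Gamma (v * θs + β) /
          (N * (1 - v * K₁)) ^ (v * θs + β - 1)) := by
        rw [norm_mul, Complex.norm_real, Real.norm_of_nonneg (by positivity), mul_assoc]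
    _ ≤ C * (N : ℝ) ^ (v * θs + β - 1 - ε) * (C' * (N : ℝ) ^ (1 - (v * θs + β))) :=
        mul_le_mul (hN v hv) (hC' v hv N hN') hpos ((by positivity : (0 : ℝ) ≤ _).trans (hN v hv))
    _ = C * C' * (N : ℝ) ^ (-ε) := by
        rw [mul_mul_mul_comm, ← Real.rpow_add hN']
        congr 2
        ring

lemma tendstoUniformlyOn_coeffAt_div_leadingTerm (hκ : ∀ j : ℕ, 1 ≤ j → 0 ≤ κ j)
    (hNA : NonArithmetic κ) (hND : NonDegenerate κ) (hR : 0 < R) (hη : 0 < η) (hφ : 0 < φ)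
    (hφ' : φ < Real.pi / 2) (hRκ : ENNReal.ofReal R ≤ genRadius κ)
    (hgθ : IsContinuation θ R η φ gθ) (hgκ : IsContinuation κ R η φ gκ)
    (hK₀ : Tendsto (fun r : ℝ => genFun κ (r : ℂ)) (𝓝[<] R) (𝓝 (K₀ : ℂ)))
    (hK₁ : Tendsto (fun r : ℝ => modDeriv 1 (genFun κ) (r : ℂ)) (𝓝[<] R) (𝓝 (K₁ : ℂ)))
    (hδ : 0 < δ)
    (hθ_exp : (fun z : ℂ => gθ z - (-(θs : ℂ) * Complex.log (1 - z / (R : ℂ))))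
      =O[𝓝[Delta0 R η φ] (R : ℂ)] fun z : ℂ => ‖1 - z / (R : ℂ)‖ ^ δ)
    (hκ_exp : (fun z : ℂ => gκ z - ((K₀ : ℂ) - (K₁ : ℂ) * (1 - z / (R : ℂ))))
      =O[𝓝[Delta0 R η φ] (R : ℂ)] fun z : ℂ => ‖1 - z / (R : ℂ)‖ ^ (1 + δ))
    (hf : DifferentiableOn ℂ f (Delta0 R η φ))
    (hf_exp : (fun z : ℂ => f z / (1 - z / (R : ℂ)) ^ (-(β : ℂ)) - 1)
        =O[𝓝[Delta0 R η φ] (R : ℂ)] fun z : ℂ => ‖1 - z / (R : ℂ)‖ ^ δ)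
    (hv₁ : 0 ≤ v₁) (hv₁₂ : v₁ ≤ v₂) (hv₂K : v₂ * K₁ < 1)
    (ha : ∀ v ∈ Set.Icc v₁ v₂, 0 < v * θs + β) :
    TendstoUniformlyOn
      (fun (N : ℕ) (v : ℝ) =>
        coeffAt N (fun z : ℂ => f z * Complex.exp ((v : ℂ) * bigG θ κ N z)) /
          (leadingTerm R K₀ K₁ θs β N v : ℂ))
      (fun _ : ℝ => (1 : ℂ)) atTop (Set.Icc v₁ v₂) := by
  have hK₁0 := nonneg_of_tendsto_modDeriv hκ hR hRκ hK₁
  have hvK : ∀ v ∈ Set.Icc v₁ v₂, v * K₁ < 1 := fun v hv =>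
    (mul_le_mul_of_nonneg_right hv.2 hK₁0).trans_lt hv₂K
  obtain ⟨C, ε, hε, hC⟩ := exists_norm_coeffAt_remainder_le_of_isContinuation hκ hNA hND hR hη hφ
    hφ' hRκ hgκ hK₀ hδ hκ_exp hgθ.1 hθ_exp hf hf_exp hK₁0 (hv₁.trans hv₁₂) hv₂K
  have hremainder := tendsto_coeffAt_remainder_mul hR hε
    (hC.mono fun N hN v hv => hN v ⟨hv₁.trans hv.1, hv.2⟩ (ha v hv).le) hvK ha
  have hmodel := (Complex.continuous_ofReal.tendsto _).comp
    (tendsto_Gamma_natFloor_div_rpow hv₁ hK₁0 hv₂K ha)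
  rw [← tendsto_prod_principal_iff]
  have hsum := hremainder.add hmodel
  rw [Complex.ofReal_one, zero_add] at hsum
  refine hsum.congr' ?_
  filter_upwards [(eventually_gt_atTop 0).prod_mk (mem_principal_self (Set.Icc v₁ v₂))]
    with ⟨N, v⟩ ⟨hN, hv⟩
  exact (coeffAt_mul_exp_bigG_div_leadingTerm hR hφ.le (ball_subset_Delta0 hR hη hφ hφ') hf hgθ hgκ
    K₀ hN (hvK v hv) (ha v hv)).symm

end Asymptotics

theorem mainTheorem10_general {θ κ : ℕ → ℝ} (hκ : ∀ j : ℕ, 1 ≤ j → 0 ≤ κ j)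
    (hNA : NonArithmetic κ) (hND : NonDegenerate κ)
    {R η φ : ℝ} (hR : 0 < R) (hη : 0 < η) (hφ : 0 < φ) (hφ' : φ < Real.pi / 2)
    (hRκ : ENNReal.ofReal R ≤ genRadius κ) (hRθ : ENNReal.ofReal R ≤ genRadius θ)
    {gθ gκ : ℂ → ℂ} (hgθ : IsContinuation θ R η φ gθ) (hgκ : IsContinuation κ R η φ gκ)
    {K₀ K₁ : ℝ} (hK₀ : Tendsto (fun r : ℝ => genFun κ (r : ℂ)) (𝓝[<] R) (𝓝 (K₀ : ℂ)))
    (hK₁ : Tendsto (fun r : ℝ => modDeriv 1 (genFun κ) (r : ℂ)) (𝓝[<] R) (𝓝 (K₁ : ℂ)))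
    (hK₁_lt : K₁ < 1) {θs δ : ℝ} (hδ : 0 < δ)
    (hθ_exp : (fun z : ℂ => gθ z - (-(θs : ℂ) * Complex.log (1 - z / (R : ℂ))))
      =O[𝓝[Delta0 R η φ] (R : ℂ)] fun z : ℂ => ‖1 - z / (R : ℂ)‖ ^ δ)
    (hκ_exp : (fun z : ℂ => gκ z - ((K₀ : ℂ) - (K₁ : ℂ) * (1 - z / (R : ℂ))))
      =O[𝓝[Delta0 R η φ] (R : ℂ)] fun z : ℂ => ‖1 - z / (R : ℂ)‖ ^ (1 + δ)) :
    (∀ (f : ℂ → ℂ) (β : ℝ), DifferentiableOn ℂ f (Delta0 R η φ) →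
      (fun z : ℂ => f z / (1 - z / (R : ℂ)) ^ (-(β : ℂ)) - 1)
        =O[𝓝[Delta0 R η φ] (R : ℂ)] (fun z : ℂ => ‖1 - z / (R : ℂ)‖ ^ δ) →
      ∀ v₁ v₂ : ℝ, 0 ≤ v₁ → v₁ ≤ v₂ → v₂ * K₁ < 1 → (∀ v ∈ Set.Icc v₁ v₂, 0 < v * θs + β) →
        TendstoUniformlyOn
          (fun (N : ℕ) (v : ℝ) =>
            coeffAt N (fun z : ℂ => f z * Complex.exp ((v : ℂ) * bigG θ κ N z)) /
              (leadingTerm R K₀ K₁ θs β N v : ℂ))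
          (fun _ : ℝ => (1 : ℂ)) atTop (Set.Icc v₁ v₂)) ∧
    (0 < θs →
      (fun N : ℕ => partitionH θ κ N) ~[atTop]
        fun N : ℕ => Real.exp ((N : ℝ) * K₀) * ((N : ℝ) * (1 - K₁)) ^ (θs - 1) /
          (R ^ N * Real.Gamma θs)) := by
  refine ⟨fun f β hf hf_exp v₁ v₂ hv₁ hv₁₂ hv₂K ha => tendstoUniformlyOn_coeffAt_div_leadingTerm hκ
    hNA hND hR hη hφ hφ' hRκ hgθ hgκ hK₀ hK₁ hδ hθ_exp hκ_exp hf hf_exp hv₁ hv₁₂ hv₂K ha,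
    fun hθs => ?_⟩
  have hone : (fun z : ℂ => (1 : ℂ) / (1 - z / (R : ℂ)) ^ (-((0 : ℝ) : ℂ)) - 1)
      =O[𝓝[Delta0 R η φ] (R : ℂ)] fun z : ℂ => ‖1 - z / (R : ℂ)‖ ^ δ := by
    simpa using isBigO_zero _ _
  have hlim := (tendstoUniformlyOn_coeffAt_div_leadingTerm (v₁ := 1) (v₂ := 1) hκ hNA hND hR hη hφ
    hφ' hRκ hgθ hgκ hK₀ hK₁ hδ hθ_exp hκ_exp (differentiableOn_const 1) hone zero_le_one le_rfl
    (by simpa using hK₁_lt) (by simpa using hθs)).tendsto_at (Set.left_mem_Icc.2 le_rfl)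
  have hR0 : 0 < ENNReal.ofReal R := ENNReal.ofReal_pos.2 hR
  simp only [one_mul, Complex.ofReal_one, leadingTerm, mul_one, add_zero,
    ← partitionH_eq_coeffAt (hR0.trans_le hRθ) (hR0.trans_le hRκ), ← Complex.ofReal_div] at hlim
  exact isEquivalent_of_tendsto_one
    (Filter.tendsto_ofReal_iff.1 (by rw [Complex.ofReal_one]; exact hlim))

theorem mainTheorem10
    (θ κ : ℕ → ℝ)
    (hθ : ∀ j : ℕ, 1 ≤ j → 0 ≤ θ j) (hκ : ∀ j : ℕ, 1 ≤ j → 0 ≤ κ j)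
    (hNA : NonArithmetic κ) (hND : NonDegenerate κ)
    (R η φ : ℝ) (hR : 0 < R) (hη : 0 < η) (hφ : 0 < φ) (hφ' : φ < Real.pi / 2)
    (hRκ : genRadius κ = ENNReal.ofReal R) (hRθ : ENNReal.ofReal R ≤ genRadius θ)
    (gθ gκ : ℂ → ℂ)
    (hgθ : IsContinuation θ R η φ gθ) (hgκ : IsContinuation κ R η φ gκ)
    -- `K₀ = g_κ(R)` and `K₁ = g_κ^{1}(R)`, defined as limits along `r ↑ R`
    (K₀ K₁ : ℝ)
    (hK₀ : Tendsto (fun r : ℝ => genFun κ (r : ℂ)) (𝓝[<] R) (𝓝 (K₀ : ℂ)))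
    (hK₁ : Tendsto (fun r : ℝ => modDeriv 1 (genFun κ) (r : ℂ)) (𝓝[<] R) (𝓝 (K₁ : ℂ)))
    (hK₁_lt : K₁ < 1)
    (θs δ : ℝ) (hθs : 0 ≤ θs) (hδ : 0 < δ)
    (hθ_exp : (fun z : ℂ => gθ z - (-(θs : ℂ) * Complex.log (1 - z / (R : ℂ))))
      =O[𝓝[Delta0 R η φ] (R : ℂ)] fun z : ℂ => ‖1 - z / (R : ℂ)‖ ^ δ)
    (hκ_exp : (fun z : ℂ => gκ z - ((K₀ : ℂ) - (K₁ : ℂ) * (1 - z / (R : ℂ))))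
      =O[𝓝[Delta0 R η φ] (R : ℂ)] fun z : ℂ => ‖1 - z / (R : ℂ)‖ ^ (1 + δ)) :
    (∀ (f : ℂ → ℂ) (β : ℝ), 0 ≤ β →
      DifferentiableOn ℂ f (Delta0 R η φ) →
      (fun z : ℂ => f z / (1 - z / (R : ℂ)) ^ (-(β : ℂ)) - 1)
        =O[𝓝[Delta0 R η φ] (R : ℂ)] (fun z : ℂ => ‖1 - z / (R : ℂ)‖ ^ δ) →
      ∀ v₁ v₂ : ℝ, 0 < v₁ → v₁ < 1 → 1 < v₂ → v₂ * K₁ < 1 →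
        (∀ v ∈ Set.Icc v₁ v₂, 0 < v * θs + β) →
        TendstoUniformlyOn
          (fun (N : ℕ) (v : ℝ) =>
            coeffAt N (fun z : ℂ => f z * Complex.exp ((v : ℂ) * bigG θ κ N z)) /
              (leadingTerm R K₀ K₁ θs β N v : ℂ))
          (fun _ : ℝ => (1 : ℂ)) atTop (Set.Icc v₁ v₂)) ∧
    (0 < θs →
      (fun N : ℕ => partitionH θ κ N) ~[atTop]
        fun N : ℕ => Real.exp ((N : ℝ) * K₀) * ((N : ℝ) * (1 - K₁)) ^ (θs - 1) /
          (R ^ N * Real.Gamma θs)) := by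
  obtain ⟨huniform, hH⟩ := mainTheorem10_general hκ hNA hND hR hη hφ hφ' hRκ.ge hRθ hgθ hgκ hK₀ hK₁
    hK₁_lt hδ hθ_exp hκ_exp
  exact ⟨fun f β _ hf hf_exp v₁ v₂ hv₁ hv₁1 hv₂1 hv₂K ha =>
    huniform f β hf hf_exp v₁ v₂ hv₁.le (hv₁1.trans hv₂1).le hv₂K ha, hH⟩
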